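/- For $i=1,2,3$ let $\eta^{(i)}=2\cos(2\pi i/7)$, let $\eta=\eta^{(1)}$ and $F=\mathbb{Q}(\eta)$, a totally real cubic field of discriminant $49$ whose ring of integers has the $\mathbb{Z}$-basis $w={}^t(\eta^2,\eta,1)$. Let $w^*$ be the dual basis of $w$ with respect to the trace of $F/\mathbb{Q}$, and put $$w^{(i)}={}^t\big((\eta^{(i)})^2,\ \eta^{(i)},\ 1\big),\qquad w^{*(i)}=\tfrac17\,{}^t\big(2(\eta^{(i)})^2+\eta^{(i)}-3,\ (\eta^{(i)})^2+2\eta^{(i)}-1,\ -3(\eta^{(i)})^2-\eta^{(i)}+7\big),$$ the vectors of conjugates of $w$ and $w^*$. Let $\langle x,y\rangle$ be the dot product and $$N_{w^*}(y)=\prod_{i=1}^3\langle y,w^{*(i)}\rangle,\qquad T_{w,+}=\{x\in\mathbb{R}^3 : \langle x,w^{(i)}\rangle>0 \text{ for } i=1,2,3\}.$$ Let $\alpha_0={}^t(1,0,1)$, $\alpha_1={}^t(2,-1,1)$, $\alpha_2={}^t(1,-1,3)$, $\alpha_3={}^t(1,-1,2)$, $\alpha_4={}^t(2,-1,2)$,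 and consider the matrices with the indicated columns $$I_1=(\alpha_0,\alpha_2,\alpha_3),\quad I_2=(\alpha_0,\alpha_3,\alpha_4),\quad I_3=(\alpha_0,\alpha_4,\alpha_1),\quad I_4=(\alpha_4,\alpha_3,\alpha_1)$$ in $SL_3(\mathbb{Z})$. Put $C_i={}^tI_i\,T_{w,+}$. For $\mathbf{k}=(k_1,k_2,k_3)\in\mathbb{Z}_{\ge1}^3$ write $|\mathbf{k}|=k_1+k_2+k_3$, $\mathbf{k}-\mathbf{1}=(k_1-1,k_2-1,k_3-1)$, $(\mathbf{k}-\mathbf{1})!=\prod_j(k_j-1)!$ and $$\zeta_{C_i}(\mathbf{k})=\sum_{x\in C_i\cap\mathbb{Z}^3}\frac{1}{x_1^{k_1}x_2^{k_2}x_3^{k_3}}.$$ For $k\ge2$ let $c_{I_i,\mathbf{k}-\mathbf{1}}$ be the coefficient of $y_1^{k_1-1}y_2^{k_2-1}y_3^{k_3-1}$ in $N_{w^*}(I_iy)^{k-1}$. Then $C_i\subset\mathbb{R}_{>0}^3$ for $i=1,\dots,4$; for every integer $k\ge2$ the series $\zeta_{C_i}(\mathbf{k})$ with $\mathbf{k}\in\mathbb{Z}_{\ge1}^3$,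 $|\mathbf{k}|=3k$, converge, and the Dedekind zeta function of $F$ satisfies $$\zeta_F(k)=\frac{1}{7\,((k-1)!)^3}\sum_{i=1}^4\ \sum_{\substack{\mathbf{k}\in\mathbb{Z}_{\ge1}^3\\ |\mathbf{k}|=3k}}(\mathbf{k}-\mathbf{1})!\;c_{I_i,\mathbf{k}-\mathbf{1}}\;\zeta_{C_i}(\mathbf{k}).$$ Moreover $$\zeta_F(2)=\frac1{7^3}\sum_{i=1}^4\sum_{\substack{\mathbf{k}\in\mathbb{Z}_{\ge1}^3\\|\mathbf{k}|=6}}c'_{i,\mathbf{k}}\,\zeta_{C_i}(\mathbf{k}),\qquad \zeta_F(3)=\frac1{7^5}\sum_{i=1}^4\sum_{\substack{\mathbf{k}\in\mathbb{Z}_{\ge1}^3\\|\mathbf{k}|=9}}c'_{i,\mathbf{k}}\,\zeta_{C_i}(\mathbf{k}),$$ where $c'_{i,\mathbf{k}}=7^{2(k-1)}\,(\mathbf{k}-\mathbf{1})!\,c_{I_i,\mathbf{k}-\mathbf{1}}/((k-1)!)^3$ (with $k=2$, resp. $k=3$) are the following integers, listed as $\mathbf{k}: c'_{1,\mathbf{k}},c'_{2,\mathbf{k}},c'_{3,\mathbf{k}},c'_{4,\mathbf{k}}$.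 For $k=2$: $(4,1,1)$: $6,6,6,42$; $(3,2,1)$: $12,10,14,28$; $(3,1,2)$: $10,14,12,28$; $(2,3,1)$: $10,12,28,14$; $(2,2,2)$: $13,21,21,21$; $(2,1,3)$: $12,28,10,14$; $(1,4,1)$: $6,6,42,6$; $(1,3,2)$: $12,14,28,10$; $(1,2,3)$: $10,28,14,12$; $(1,1,4)$: $6,42,6,6$. For $k=3$: $(7,1,1)$: $90,90,90,4410$; $(6,2,1)$: $180,150,210,2940$; $(6,1,2)$: $150,210,180,2940$; $(5,3,1)$: $276,222,462,1764$; $(5,2,2)$: $258,336,378,2058$; $(5,1,3)$: $222,462,276,1764$; $(4,4,1)$: $279,279,945,945$; $(4,3,2)$: $327,462,735,1281$; $(4,2,3)$: $318,693,504,1302$; $(4,1,4)$: $279,945,279,945$; $(3,5,1)$: $222,276,1764,462$; $(3,4,2)$: $318,504,1302,693$; $(3,3,3)$: $349,847,847,847$; $(3,2,4)$: $327,1281,462,735$; $(3,1,5)$: $276,1764,222,462$; $(2,6,1)$: $150,180,2940,210$; $(2,5,2)$: $258,378,2058,336$; $(2,4,3)$: $327,735,1281,462$; $(2,3,4)$: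 $318,1302,693,504$; $(2,2,5)$: $258,2058,336,378$; $(2,1,6)$: $180,2940,150,210$; $(1,7,1)$: $90,90,4410,90$; $(1,6,2)$: $180,210,2940,150$; $(1,5,3)$: $276,462,1764,222$; $(1,4,4)$: $279,945,945,279$; $(1,3,5)$: $222,1764,462,276$; $(1,2,6)$: $150,2940,210,180$; $(1,1,7)$: $90,4410,90,90$. -/

import Mathlib

open scoped BigOperators Matrix Nat IntermediateField

noncomputable section

namespace ConicalZeta

/-! ### Conical zeta values -/

/-- The terms `1 / x ^ κ` of the conical zeta value, indexed by the lattice points `x` of `C`. -/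
def conicalTerm {n : ℕ} (C : Set (Fin n → ℝ)) (κ : Fin n → ℕ)
    (x : {x : Fin n → ℤ // (fun j => (x j : ℝ)) ∈ C}) : ℝ :=
  1 / ∏ j, (x.1 j : ℝ) ^ κ j

/-- The conical zeta value `ζ_C(κ) = ∑_{x ∈ C ∩ ℤⁿ} 1 / x ^ κ`. -/
def conicalZeta {n : ℕ} (C : Set (Fin n → ℝ)) (κ : Fin n → ℕ) : ℝ :=
  ∑' x, conicalTerm C κ x

/-- The multi-indices `κ` with all entries at least `1` and weight `|κ| = N`. -/
def multiIndices (n N : ℕ) : Finset (Fin n → ℕ) :=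
  (Finset.piAntidiag Finset.univ N).filter fun κ => ∀ j, 1 ≤ κ j

theorem mem_multiIndices {n N : ℕ} {κ : Fin n → ℕ} :
    κ ∈ multiIndices n N ↔ ∑ j, κ j = N ∧ ∀ j, 1 ≤ κ j := by
  simp [multiIndices]

/-! ### Norm polynomials and positive cones

A vector `w ∈ Fⁿ` is given by its conjugates: `w i j` is the `j`-th coordinate of `w^(i)`. -/

/-- The norm polynomial `N_w(y) = ∏ᵢ ⟨y, w^(i)⟩`. -/
def normPoly {n : ℕ} (w : Fin n → Fin n → ℝ) : MvPolynomial (Fin n) ℝ :=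
  ∏ i, ∑ j, MvPolynomial.C (w i j) * MvPolynomial.X j

/-- Substitution of `A y` for `y` in a polynomial. -/
def substMatrix {n : ℕ} (A : Matrix (Fin n) (Fin n) ℤ) (p : MvPolynomial (Fin n) ℝ) :
    MvPolynomial (Fin n) ℝ :=
  MvPolynomial.bind₁
    (fun j => ∑ l, MvPolynomial.C ((A j l : ℤ) : ℝ) * MvPolynomial.X l) p

/-- The coefficient of `y ^ m` in `N_w(A y) ^ (k - 1)`. -/
def normCoeff {n : ℕ} (w : Fin n → Fin n → ℝ) (A : Matrix (Fin n) (Fin n) ℤ) (k : ℕ)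
    (m : Fin n → ℕ) : ℝ :=
  MvPolynomial.coeff (Finsupp.equivFunOnFinite.symm m) (substMatrix A (normPoly w) ^ (k - 1))

/-- `T_{w,+} = {x | ∀ i, ⟨x, w^(i)⟩ > 0}`. -/
def positiveCone {n : ℕ} (w : Fin n → Fin n → ℝ) : Set (Fin n → ℝ) :=
  {x | ∀ i, 0 < x ⬝ᵥ w i}

/-- The image of a set under the transpose of an integral matrix. -/
def transposeImage {n : ℕ} (A : Matrix (Fin n) (Fin n) ℤ) (T : Set (Fin n → ℝ)) :
    Set (Fin n → ℝ) :=
  (fun x => (A.map (Int.cast : ℤ → ℝ))ᵀ *ᵥ x) '' T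

/-! ### The cubic field `ℚ(2 cos(2π/7))` -/

/-- `η^(1), η^(2), η^(3) = 2 cos(2π/7), 2 cos(4π/7), 2 cos(6π/7)`. -/
def eta (i : Fin 3) : ℝ := 2 * Real.cos (2 * ((i : ℕ) + 1) * Real.pi / 7)

/-- The field `F = ℚ(η)`. -/
abbrev CubicField : IntermediateField ℚ ℝ := ℚ⟮2 * Real.cos (2 * Real.pi / 7)⟯

theorem finiteDimensional_cubicField : FiniteDimensional ℚ CubicField := by
  apply IntermediateField.adjoin.finiteDimensional
  have h := Real.isIntegral_two_mul_cos_rat_mul_pi (2 / 7)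
  have e : 2 * Real.cos (((2 / 7 : ℚ) : ℝ) * Real.pi) = 2 * Real.cos (2 * Real.pi / 7) := by
    push_cast
    ring_nf
  rw [e] at h
  exact h.tower_top

instance instNumberFieldCubicField : NumberField CubicField where
  to_charZero := inferInstance
  to_finiteDimensional := finiteDimensional_cubicField

/-- The conjugates of the integral basis `w = (η², η, 1)`. -/
def w (i : Fin 3) : Fin 3 → ℝ := ![eta i ^ 2, eta i, 1]

/-- The conjugates of the dual basis `w*` of `w` with respect to the trace. -/
def wStar (i : Fin 3) : Fin 3 → ℝ :=
  ![(2 * eta i ^ 2 + eta i - 3) / 7, (eta i ^ 2 + 2 * eta i - 1) / 7,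
    (-3 * eta i ^ 2 - eta i + 7) / 7]

theorem eta_cubic (i : Fin 3) : eta i ^ 3 + eta i ^ 2 - 2 * eta i - 1 = 0 := by
  have key : ∀ (θ : ℝ) (m : ℕ), 7 * θ = m * (2 * Real.pi) → Real.cos θ ≠ 1 →
      (2 * Real.cos θ) ^ 3 + (2 * Real.cos θ) ^ 2 - 2 * (2 * Real.cos θ) - 1 = 0 := by
    intro θ m h hne
    have h4 : Real.cos (2 * (2 * θ)) = Real.cos (3 * θ) := by
      have e : 2 * (2 * θ) = m * (2 * Real.pi) - 3 * θ := by linarith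
      rw [e, Real.cos_nat_mul_two_pi_sub]
    rw [Real.cos_two_mul, Real.cos_two_mul, Real.cos_three_mul] at h4
    have hz : (2 * Real.cos θ - 2) *
        ((2 * Real.cos θ) ^ 3 + (2 * Real.cos θ) ^ 2 - 2 * (2 * Real.cos θ) - 1) = 0 := by
      linear_combination 2 * h4
    rcases mul_eq_zero.mp hz with h0 | h0
    · exact absurd (by linarith) hne
    · exact h0
  have hpi := Real.pi_pos
  unfold eta
  refine key _ ((i : ℕ) + 1) (by push_cast; ring) ?_
  have hi : (i : ℕ) ≤ 2 := by omega
  have hi' : ((i : ℕ) : ℝ) ≤ 2 := by exact_mod_cast hi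
  have h0 : (0 : ℝ) ≤ ((i : ℕ) : ℝ) := Nat.cast_nonneg _
  have hlt : Real.cos (2 * ((i : ℕ) + 1) * Real.pi / 7) < Real.cos 0 :=
    Real.cos_lt_cos_of_nonneg_of_le_pi le_rfl (by nlinarith) (by positivity)
  rw [Real.cos_zero] at hlt
  exact hlt.ne

theorem eta_one : eta 1 = eta 0 ^ 2 - 2 := by
  have h := Real.cos_two_mul (2 * Real.pi / 7)
  have e : (2 : ℝ) * (2 * Real.pi / 7) = 2 * (1 + 1) * Real.pi / 7 := by ring
  rw [e] at h
  simp only [eta, Fin.val_one, Fin.val_zero, Nat.cast_one, Nat.cast_zero, zero_add, mul_one]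
  rw [h]
  ring

theorem eta_two : eta 2 = -eta 0 ^ 2 - eta 0 + 1 := by
  have h := Real.cos_three_mul (2 * Real.pi / 7)
  have e : (3 : ℝ) * (2 * Real.pi / 7) = 2 * (2 + 1) * Real.pi / 7 := by ring
  rw [e] at h
  have hc := eta_cubic 0
  have e2 : eta 2 = eta 0 ^ 3 - 3 * eta 0 := by
    simp only [eta, Fin.val_two, Fin.val_zero, Nat.cast_ofNat, Nat.cast_zero, zero_add, mul_one]
    rw [h]
    ring
  rw [e2]
  linear_combination hc

/-- `w*` is the dual basis of `w`: `Tr(w_a w*_b) = δ_{ab}`. -/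
theorem sum_w_mul_wStar (a b : Fin 3) :
    ∑ i, w i a * wStar i b = if a = b then 1 else 0 := by
  have hc := eta_cubic 0
  have h1 := eta_one
  have h2 := eta_two
  have hx3 : eta 0 ^ 3 = -eta 0 ^ 2 + 2 * eta 0 + 1 := by linarith
  have hx4 : eta 0 ^ 4 = 3 * eta 0 ^ 2 - eta 0 - 1 := by
    linear_combination (eta 0 - 1) * hx3
  have hs1 : eta 1 ^ 2 = -eta 0 ^ 2 - eta 0 + 3 := by
    rw [h1]; linear_combination hx4
  have hs2 : eta 2 ^ 2 = eta 0 + 2 := by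
    rw [h2]; linear_combination hx4 + 2 * hx3
  rw [Fin.sum_univ_three]
  fin_cases a <;> fin_cases b <;> simp [w, wStar, hs1, hs2] <;> simp only [h1, h2] <;> ring_nf <;>
    (try simp only [hx3, hx4]) <;> ring_nf

/-! ### The cone decomposition -/

/-- The vectors `α₀, …, α₄`. -/
def alpha : Fin 5 → Fin 3 → ℤ :=
  ![![1, 0, 1], ![2, -1, 1], ![1, -1, 3], ![1, -1, 2], ![2, -1, 2]]

/-- The `3 × 3` matrix with the given columns. -/
def ofColumns (u v z : Fin 3 → ℤ) : Matrix (Fin 3) (Fin 3) ℤ := (Matrix.of ![u, v, z])ᵀ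

/-- The matrices `I₁ = (α₀, α₂, α₃)`, `I₂ = (α₀, α₃, α₄)`, `I₃ = (α₀, α₄, α₁)`,
`I₄ = (α₄, α₃, α₁)`, indexed from `0`. -/
def coneMatrix : Fin 4 → Matrix (Fin 3) (Fin 3) ℤ :=
  ![ofColumns (alpha 0) (alpha 2) (alpha 3), ofColumns (alpha 0) (alpha 3) (alpha 4),
    ofColumns (alpha 0) (alpha 4) (alpha 1), ofColumns (alpha 4) (alpha 3) (alpha 1)]

/-- The columns of each `Iᵢ` form a positively oriented basis of `ℤ³`. -/
theorem det_coneMatrix (i : Fin 4) : (coneMatrix i).det = 1 := by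
  fin_cases i <;> simp [coneMatrix, ofColumns, alpha, Matrix.det_fin_three]

/-- `Cᵢ = ᵗIᵢ T_{w,+}`. -/
def dualCone (i : Fin 4) : Set (Fin 3 → ℝ) := transposeImage (coneMatrix i) (positiveCone w)

/-- The tabulated integers `c'_{i, κ}` for `k = 2`; the row of `κ` lists `i = 1, 2, 3, 4`. -/
def tableTwo (κ : Fin 3 → ℕ) : Fin 4 → ℕ :=
  match κ 0, κ 1, κ 2 with
  | 4, 1, 1 => ![6, 6, 6, 42]
  | 3, 2, 1 => ![12, 10, 14, 28]
  | 3, 1, 2 => ![10, 14, 12, 28]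
  | 2, 3, 1 => ![10, 12, 28, 14]
  | 2, 2, 2 => ![13, 21, 21, 21]
  | 2, 1, 3 => ![12, 28, 10, 14]
  | 1, 4, 1 => ![6, 6, 42, 6]
  | 1, 3, 2 => ![12, 14, 28, 10]
  | 1, 2, 3 => ![10, 28, 14, 12]
  | 1, 1, 4 => ![6, 42, 6, 6]
  | _, _, _ => 0

/-- The tabulated integers `c'_{i, κ}` for `k = 3`; the row of `κ` lists `i = 1, 2, 3, 4`. -/
def tableThree (κ : Fin 3 → ℕ) : Fin 4 → ℕ :=
  match κ 0, κ 1, κ 2 with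
  | 7, 1, 1 => ![90, 90, 90, 4410]
  | 6, 2, 1 => ![180, 150, 210, 2940]
  | 6, 1, 2 => ![150, 210, 180, 2940]
  | 5, 3, 1 => ![276, 222, 462, 1764]
  | 5, 2, 2 => ![258, 336, 378, 2058]
  | 5, 1, 3 => ![222, 462, 276, 1764]
  | 4, 4, 1 => ![279, 279, 945, 945]
  | 4, 3, 2 => ![327, 462, 735, 1281]
  | 4, 2, 3 => ![318, 693, 504, 1302]
  | 4, 1, 4 => ![279, 945, 279, 945]
  | 3, 5, 1 => ![222, 276, 1764, 462]
  | 3, 4, 2 => ![318, 504, 1302, 693]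
  | 3, 3, 3 => ![349, 847, 847, 847]
  | 3, 2, 4 => ![327, 1281, 462, 735]
  | 3, 1, 5 => ![276, 1764, 222, 462]
  | 2, 6, 1 => ![150, 180, 2940, 210]
  | 2, 5, 2 => ![258, 378, 2058, 336]
  | 2, 4, 3 => ![327, 735, 1281, 462]
  | 2, 3, 4 => ![318, 1302, 693, 504]
  | 2, 2, 5 => ![258, 2058, 336, 378]
  | 2, 1, 6 => ![180, 2940, 150, 210]
  | 1, 7, 1 => ![90, 90, 4410, 90]
  | 1, 6, 2 => ![180, 210, 2940, 150]
  | 1, 5, 3 => ![276, 462, 1764, 222]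
  | 1, 4, 4 => ![279, 945, 945, 279]
  | 1, 3, 5 => ![222, 1764, 462, 276]
  | 1, 2, 6 => ![150, 2940, 210, 180]
  | 1, 1, 7 => ![90, 4410, 90, 90]
  | _, _, _ => 0

end ConicalZeta

end

noncomputable section

namespace ConicalZeta

/-! ### Numerical bounds for the conjugates of `η` -/

/-! This is Shintani's method with an explicit fundamental domain. Pairing `α_k` with `w*` gives a
totally positive element `a_k` of the inverse different, and `vertex k` is its vector of conjugates,
a point of the open octant. With the totally positive units `ε₁ = η² - η` and `ε₂ = η⁻²` one has `a₁
= ε₁a₀`, `a₂ = ε₂a₀`, `a₃ = ε₁ε₂a₀`, while `2a₄ = a₀ + a₁ + a₃`. Hence the four cells, the cones on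
the columns of the `I_m`, fill a quadrilateral whose opposite sides are matched by `ε₁` and `ε₂`,
and their translates under the group `⟨ε₁, ε₂⟩` tile the octant up to a null set (`tsum_cellCount`).

The tiling is proved by ray casting. The indicator of a cell is the sum of signed crossings of its
edges with a ray from `t` along the third axis (`indicator_openCone`). Inner edges cancel, opposite
outer edges are unit translates of each other (`cellCount_eq`), and the sum over all units
telescopes to a boundary value, which is 1.

For totally positive `c`, `((k-1)!)³ / N(c)^k` is the integral of `(t₁t₂t₃)^(k-1) exp(-⟨c,t⟩)` over
the octant. Cutting by the tiling turns it into a sum, over the unit multiples of `c`, of integrals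
over the four cells. On a cell, the substitution `t = B y` with `det B = 1/7` turns `t₁t₂t₃` into
`N_{w*}(I_m y)`; expanding into monomials gives the factorials and the inverse powers of the lattice
point `ᵗB c` of `C_m` (`ofReal_coneSum`, `tsum_coneSum`). The coefficients of `N_{w*}(I_m y)` are
nonnegative, so all interchanges are Tonelli in `ENNReal`.

Arithmetic supplies the rest. The ring of integers is `ℤ[η]` (`toInteger_surjective`), it is
principal, units of every signature exist, and `⟨ε₁, ε₂⟩` is the full group of totally positive
units, which is itself read off from the tiling (`exists_unitPow_of_totallyPositive`). So nonzero
ideals are orbits of totally positive integers (`orbitEquiv`), and since `I_m` is unimodular these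
integers are the lattice points of `C_m` (`latticeEquiv`). -/

theorem eta_zero_gt : 1.24 < eta 0 := by
  have hc := eta_cubic 0
  -- The cubic has two further roots, both negative, so an a priori bound is needed to single out
  -- the root being located; it comes from `cos (π/3) = 1/2`.
  have h1 : 1 < eta 0 := by
    have h : Real.cos (Real.pi / 3) < Real.cos (2 * Real.pi / 7) :=
      Real.cos_lt_cos_of_nonneg_of_le_pi (by positivity) (by linarith [Real.pi_pos])
        (by linarith [Real.pi_pos])
    rw [Real.cos_pi_div_three] at h
    simp only [eta, Fin.val_zero, Nat.cast_zero, zero_add, mul_one]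
    linarith
  by_contra h
  push Not at h
  nlinarith [mul_nonneg (sub_nonneg.2 h1.le) (sub_nonneg.2 h)]

theorem eta_zero_lt : eta 0 < 1.25 := by
  have hc := eta_cubic 0
  by_contra h
  push Not at h
  nlinarith [mul_nonneg (sub_nonneg.2 h) (sub_nonneg.2 h)]

theorem eta_zero_pow_three : eta 0 ^ 3 = -eta 0 ^ 2 + 2 * eta 0 + 1 := by
  linarith [eta_cubic 0]

theorem eta_zero_pow_four : eta 0 ^ 4 = 3 * eta 0 ^ 2 - eta 0 - 1 := by
  linear_combination (eta 0 - 1) * eta_zero_pow_three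

theorem eta_one_sq : eta 1 ^ 2 = -eta 0 ^ 2 - eta 0 + 3 := by
  rw [eta_one]; linear_combination eta_zero_pow_four

theorem eta_two_sq : eta 2 ^ 2 = eta 0 + 2 := by
  rw [eta_two]; linear_combination eta_zero_pow_four + 2 * eta_zero_pow_three

/-- The relation `wStar` is dual to `w`, in the transposed form. -/
theorem sum_wStar_mul_w (i l : Fin 3) :
    ∑ b, wStar i b * w l b = if i = l then 1 else 0 := by
  have h : (Matrix.of w)ᵀ * Matrix.of wStar = 1 := by
    ext a b
    rw [Matrix.mul_apply, Matrix.one_apply]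
    exact sum_w_mul_wStar a b
  have h' := mul_eq_one_comm.1 h
  have h2 := congrFun (congrFun h' i) l
  rw [Matrix.mul_apply, Matrix.one_apply] at h2
  exact h2

/-! ### The conjugates of the vertices of the cones -/

/-- The conjugates `⟨α_k, w*^(i)⟩`. -/
def vertex (k : Fin 5) (i : Fin 3) : ℝ := ∑ j, (alpha k j : ℝ) * wStar i j

/-- All conjugates are expressed through the single real number `eta 0`, so that inequalities become
checks on the interval `(1.24, 1.25)`. -/
theorem vertex_zero : vertex 0 =
    ![(4 - eta 0 ^ 2) / 7, (eta 0 ^ 2 + eta 0 + 1) / 7, (2 - eta 0) / 7] := by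
  ext i
  fin_cases i <;> simp [vertex, Fin.sum_univ_three, alpha, wStar, eta_one_sq, eta_two_sq] <;>
    (try simp only [eta_one, eta_two]) <;> ring

theorem vertex_one : vertex 1 =
    ![(2 - eta 0) / 7, (4 - eta 0 ^ 2) / 7, (eta 0 ^ 2 + eta 0 + 1) / 7] := by
  ext i
  fin_cases i <;> simp [vertex, Fin.sum_univ_three, alpha, wStar, eta_one_sq, eta_two_sq] <;>
    (try simp only [eta_one, eta_two]) <;> ring

theorem vertex_two : vertex 2 =
    ![(-8 * eta 0 ^ 2 - 4 * eta 0 + 19) / 7, (4 * eta 0 ^ 2 + 8 * eta 0 + 3) / 7,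
      (4 * eta 0 ^ 2 - 4 * eta 0 - 1) / 7] := by
  ext i
  fin_cases i <;> simp [vertex, Fin.sum_univ_three, alpha, wStar, eta_one_sq, eta_two_sq] <;>
    (try simp only [eta_one, eta_two]) <;> ring

theorem vertex_three : vertex 3 =
    ![(-5 * eta 0 ^ 2 - 3 * eta 0 + 12) / 7, (2 * eta 0 ^ 2 + 5 * eta 0 + 3) / 7,
      (3 * eta 0 ^ 2 - 2 * eta 0 - 1) / 7] := by
  ext i
  fin_cases i <;> simp [vertex, Fin.sum_univ_three, alpha, wStar, eta_one_sq, eta_two_sq] <;>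
    (try simp only [eta_one, eta_two]) <;> ring

theorem vertex_four : vertex 4 =
    ![(-3 * eta 0 ^ 2 - 2 * eta 0 + 9) / 7, (eta 0 ^ 2 + 3 * eta 0 + 4) / 7,
      (2 * eta 0 ^ 2 - eta 0 + 1) / 7] := by
  ext i
  fin_cases i <;> simp [vertex, Fin.sum_univ_three, alpha, wStar, eta_one_sq, eta_two_sq] <;>
    (try simp only [eta_one, eta_two]) <;> ring

theorem vertex_pos (k : Fin 5) (i : Fin 3) : 0 < vertex k i := by
  have h1 := eta_zero_gt
  have h2 := eta_zero_lt
  have hc := eta_cubic 0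
  fin_cases k <;> simp only [Fin.zero_eta, Fin.mk_one, Fin.reduceFinMk, vertex_zero, vertex_one,
      vertex_two, vertex_three, vertex_four] <;>
    fin_cases i <;> simp <;> nlinarith

/-- Columns of the cone matrices. -/
def coneIndex : Fin 4 → Fin 3 → Fin 5 := ![![0, 2, 3], ![0, 3, 4], ![0, 4, 1], ![4, 3, 1]]

theorem coneMatrix_apply (i : Fin 4) (j l : Fin 3) :
    coneMatrix i j l = alpha (coneIndex i l) j := by
  fin_cases i <;> fin_cases l <;> rfl

/-! ### The norm polynomial in coordinates -/

theorem prod_dotProduct_wStar (y : Fin 3 → ℝ) :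
    ∏ i, y ⬝ᵥ wStar i =
      (-y 0 ^ 3 - 2 * y 0 ^ 2 * y 1 + 2 * y 0 ^ 2 * y 2 + y 0 * y 1 ^ 2 + 5 * y 0 * y 1 * y 2
        + y 0 * y 2 ^ 2 + y 1 ^ 3 - 3 * y 1 ^ 2 * y 2 - 4 * y 1 * y 2 ^ 2 - y 2 ^ 3) / 49 := by
  have h := eta_zero_pow_three
  have e : ∏ i, y ⬝ᵥ wStar i = ∏ i, (![(2 * eta 0 ^ 2 + eta 0 - 3) * y 0 + (eta 0 ^ 2 + 2 * eta 0
      - 1) * y 1 + (-3 * eta 0 ^ 2 - eta 0 + 7) * y 2, (-1 * eta 0 ^ 2 - 2 * eta 0 + 1) * y 0 + (1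
      * eta 0 ^ 2 - 1 * eta 0 - 2) * y 1 + (2 * eta 0 ^ 2 + 3 * eta 0 + 0) * y 2, (-1 * eta 0 ^ 2
      + 1 * eta 0 + 2) * y 0 + (-2 * eta 0 ^ 2 - 1 * eta 0 + 3) * y 1 + (1 * eta 0 ^ 2 - 2 * eta 0
      + 0) * y 2] : Fin 3 → ℝ) i / 7 := by
    refine Finset.prod_congr rfl fun i _ => ?_
    fin_cases i <;> simp [dotProduct, Fin.sum_univ_three, wStar, eta_one_sq, eta_two_sq] <;>
      (try simp only [eta_one, eta_two]) <;> ring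
  rw [e, Fin.prod_univ_three]
  simp only [Matrix.cons_val]
  generalize eta 0 = x at h
  -- The multiplier is the quotient on dividing the product by the cubic of `η`; `343` collects the
  -- three denominators `7`.
  linear_combination (((-1)*x^0 + (-9)*x^1 + (1)*x^2 + (2)*x^3)*(y 0^3*y 1^0*y 2^0) + ((-15)*x^0 +
      (-9)*x^1 + (15)*x^2 + (3)*x^3)*(y 0^2*y 1^1*y 2^0) + ((35)*x^1 + (-9)*x^3)*(y 0^2*y 1^0*y
      2^1) + ((-12)*x^0 + (18)*x^1 + (12)*x^2 + (-3)*x^3)*(y 0^1*y 1^2*y 2^0) + ((42)*x^0 +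
      (35)*x^1 + (-42)*x^2 + (-12)*x^3)*(y 0^1*y 1^1*y 2^1) + ((7)*x^0 + (-42)*x^1 + (-7)*x^2 +
      (13)*x^3)*(y 0^1*y 1^0*y 2^2) + ((1)*x^0 + (9)*x^1 + (-1)*x^2 + (-2)*x^3)*(y 0^0*y 1^3*y
      2^0) + ((21)*x^0 + (-28)*x^1 + (-21)*x^2 + (3)*x^3)*(y 0^0*y 1^2*y 2^1) + ((-28)*x^0 +
      (-35)*x^1 + (28)*x^2 + (11)*x^3)*(y 0^0*y 1^1*y 2^2) + ((-7)*x^0 + (14)*x^1 + (7)*x^2 +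
      (-6)*x^3)*(y 0^0*y 1^0*y 2^3)) / 343 * h

theorem eval_normPoly (w : Fin 3 → Fin 3 → ℝ) (y : Fin 3 → ℝ) :
    MvPolynomial.eval y (normPoly w) = ∏ i, y ⬝ᵥ w i := by
  simp [normPoly, dotProduct, mul_comm]

theorem eval_substMatrix {n : ℕ} (A : Matrix (Fin n) (Fin n) ℤ) (p : MvPolynomial (Fin n) ℝ)
    (y : Fin n → ℝ) :
    MvPolynomial.eval y (substMatrix A p) =
      MvPolynomial.eval (A.map (Int.cast : ℤ → ℝ) *ᵥ y) p := by
  rw [substMatrix, MvPolynomial.eval, MvPolynomial.eval₂Hom_bind₁]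
  congr 2
  ext j
  simp [Matrix.mulVec, dotProduct]

/-- A polynomial function given by its coefficients determines them. -/
theorem coeff_of_eval {n N : ℕ} (p : MvPolynomial (Fin n) ℝ) (q : (Fin n → ℕ) → ℝ)
    (h : ∀ y, MvPolynomial.eval y p = ∑ κ ∈ multiIndices n N, q κ * ∏ j, y j ^ (κ j - 1))
    {κ : Fin n → ℕ} (hκ : κ ∈ multiIndices n N) :
    MvPolynomial.coeff (Finsupp.equivFunOnFinite.symm fun j => κ j - 1) p = q κ := by
  have hp : p = ∑ κ ∈ multiIndices n N,
      MvPolynomial.monomial (Finsupp.equivFunOnFinite.symm fun j => κ j - 1) (q κ) := by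
    apply MvPolynomial.funext
    intro y
    rw [h, map_sum]
    refine Finset.sum_congr rfl fun κ _ => ?_
    rw [MvPolynomial.eval_monomial, Finsupp.prod_fintype _ _ (by simp)]
    simp
  rw [hp, MvPolynomial.coeff_sum, Finset.sum_eq_single κ]
  · simp
  · intro b hb hne
    rw [MvPolynomial.coeff_monomial, if_neg]
    intro he
    apply hne
    have := Finsupp.equivFunOnFinite.symm.injective he
    ext j
    have hj := congrFun this j
    -- Truncated subtraction makes `κ ↦ κ - 1` injective only because all entries are at least `1`.
    have h1 := (mem_multiIndices.1 hb).2 j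
    have h2 := (mem_multiIndices.1 hκ).2 j
    change b j - 1 = κ j - 1 at hj
    omega
  · exact fun h => absurd hκ h

/-- Coefficients of `49 N_{w*}(I_i y)`. -/
theorem eval_coneMatrix (i : Fin 4) (y : Fin 3 → ℝ) :
    MvPolynomial.eval y (substMatrix (coneMatrix i) (normPoly wStar)) =
     (![y 0 ^ 3 + 6 * y 0 ^ 2 * y 1 + 5 * y 0 ^ 2 * y 2 + 5 * y 0 * y 1 ^ 2 + 13 * y 0 * y 1 * y 2
          + 6 * y 0 * y 2 ^ 2 + y 1 ^ 3 + 6 * y 1 ^ 2 * y 2 + 5 * y 1 * y 2 ^ 2 + y 2 ^ 3,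
        y 0 ^ 3 + 5 * y 0 ^ 2 * y 1 + 7 * y 0 ^ 2 * y 2 + 6 * y 0 * y 1 ^ 2 + 21 * y 0 * y 1 * y 2
          + 14 * y 0 * y 2 ^ 2 + y 1 ^ 3 + 7 * y 1 ^ 2 * y 2 + 14 * y 1 * y 2 ^ 2 + 7 * y 2 ^ 3,
        y 0 ^ 3 + 7 * y 0 ^ 2 * y 1 + 6 * y 0 ^ 2 * y 2 + 14 * y 0 * y 1 ^ 2 + 21 * y 0 * y 1 * y 2
          + 5 * y 0 * y 2 ^ 2 + 7 * y 1 ^ 3 + 14 * y 1 ^ 2 * y 2 + 7 * y 1 * y 2 ^ 2 + y 2 ^ 3,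
        7 * y 0 ^ 3 + 14 * y 0 ^ 2 * y 1 + 14 * y 0 ^ 2 * y 2 + 7 * y 0 * y 1 ^ 2
          + 21 * y 0 * y 1 * y 2 + 7 * y 0 * y 2 ^ 2 + y 1 ^ 3 + 5 * y 1 ^ 2 * y 2
          + 6 * y 1 * y 2 ^ 2 + y 2 ^ 3] : Fin 4 → ℝ) i / 49 := by
  rw [eval_substMatrix, eval_normPoly, prod_dotProduct_wStar]
  fin_cases i <;>
    simp [Matrix.mulVec, dotProduct, Fin.sum_univ_three, coneMatrix, ofColumns, alpha] <;> ring

theorem normCoeff_of_eval {k : ℕ} (i : Fin 4) (q : (Fin 3 → ℕ) → ℝ) {N : ℕ}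
    (h : ∀ y, MvPolynomial.eval y (substMatrix (coneMatrix i) (normPoly wStar)) ^ (k - 1) =
      ∑ κ ∈ multiIndices 3 N, q κ * ∏ j, y j ^ (κ j - 1))
    {κ : Fin 3 → ℕ} (hκ : κ ∈ multiIndices 3 N) :
    normCoeff wStar (coneMatrix i) k (fun j => κ j - 1) = q κ :=
  coeff_of_eval _ q (fun y => by rw [map_pow, h]) hκ

/-! ### The tabulated coefficients for `k = 2` and `k = 3` -/

theorem multiIndices_three_six : multiIndices 3 6 =
    [![4, 1, 1], ![3, 2, 1], ![3, 1, 2], ![2, 3, 1], ![2, 2, 2], ![2, 1, 3], ![1, 4, 1],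
      ![1, 3, 2], ![1, 2, 3], ![1, 1, 4]].toFinset := by
  decide +kernel

theorem multiIndices_three_nine : multiIndices 3 9 =
    [![7, 1, 1], ![6, 2, 1], ![6, 1, 2], ![5, 3, 1], ![5, 2, 2], ![5, 1, 3], ![4, 4, 1],
      ![4, 3, 2], ![4, 2, 3], ![4, 1, 4], ![3, 5, 1], ![3, 4, 2], ![3, 3, 3], ![3, 2, 4],
      ![3, 1, 5], ![2, 6, 1], ![2, 5, 2], ![2, 4, 3], ![2, 3, 4], ![2, 2, 5], ![2, 1, 6],
      ![1, 7, 1], ![1, 6, 2], ![1, 5, 3], ![1, 4, 4], ![1, 3, 5], ![1, 2, 6],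
      ![1, 1, 7]].toFinset := by
  decide +kernel

theorem normCoeff_two (i : Fin 4) {κ : Fin 3 → ℕ} (hκ : κ ∈ multiIndices 3 6) :
    normCoeff wStar (coneMatrix i) 2 (fun j => κ j - 1) =
      tableTwo κ i / 49 / ((∏ j, (κ j - 1).factorial : ℕ) : ℝ) := by
  refine normCoeff_of_eval i
    (fun κ => tableTwo κ i / 49 / ((∏ j, (κ j - 1).factorial : ℕ) : ℝ)) (fun y => ?_) hκ
  rw [multiIndices_three_six, List.sum_toFinset _ (by decide), eval_coneMatrix]
  fin_cases i <;>
    simp [tableTwo, Fin.prod_univ_three, Nat.factorial] <;> ring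

-- The factor `8` is `((3 - 1)!)³`, the normalisation in `c'`.
set_option maxHeartbeats 2000000 in
theorem normCoeff_three (i : Fin 4) {κ : Fin 3 → ℕ} (hκ : κ ∈ multiIndices 3 9) :
    normCoeff wStar (coneMatrix i) 3 (fun j => κ j - 1) =
      8 * (tableThree κ i / 49 ^ 2 / ((∏ j, (κ j - 1).factorial : ℕ) : ℝ)) := by
  refine normCoeff_of_eval i
    (fun κ => 8 * (tableThree κ i / 49 ^ 2 / ((∏ j, (κ j - 1).factorial : ℕ) : ℝ)))
    (fun y => ?_) hκ
  rw [multiIndices_three_nine, List.sum_toFinset _ (by decide), eval_coneMatrix]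
  fin_cases i <;>
    simp [tableThree, Fin.prod_univ_three, Nat.factorial] <;> ring

theorem tableTwo_eq (i : Fin 4) {κ : Fin 3 → ℕ} (hκ : κ ∈ multiIndices 3 6) :
    (tableTwo κ i : ℝ) =
      7 ^ 2 * (((∏ j, (κ j - 1).factorial : ℕ) : ℝ) / ((2 - 1).factorial : ℝ) ^ 3 *
        normCoeff wStar (coneMatrix i) 2 (fun j => κ j - 1)) := by
  have h : ((∏ j, (κ j - 1).factorial : ℕ) : ℝ) ≠ 0 := by
    exact_mod_cast Finset.prod_ne_zero_iff.2 fun j _ => Nat.factorial_ne_zero _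
  rw [normCoeff_two i hκ]
  simp only [Nat.reduceSub, Nat.factorial_one, Nat.cast_one]
  field_simp
  norm_num

theorem tableThree_eq (i : Fin 4) {κ : Fin 3 → ℕ} (hκ : κ ∈ multiIndices 3 9) :
    (tableThree κ i : ℝ) =
      7 ^ 4 * (((∏ j, (κ j - 1).factorial : ℕ) : ℝ) / ((3 - 1).factorial : ℝ) ^ 3 *
        normCoeff wStar (coneMatrix i) 3 (fun j => κ j - 1)) := by
  have h : ((∏ j, (κ j - 1).factorial : ℕ) : ℝ) ≠ 0 := by
    exact_mod_cast Finset.prod_ne_zero_iff.2 fun j _ => Nat.factorial_ne_zero _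
  rw [normCoeff_three i hκ]
  simp only [Nat.reduceSub, Nat.factorial_two, Nat.cast_ofNat]
  field_simp
  ring

end ConicalZeta

namespace ConicalZeta

/-! ### Signed crossing numbers -/

/-- The determinant of three vectors of `ℝ³`. -/
def triple (a b c : Fin 3 → ℝ) : ℝ :=
  a 0 * (b 1 * c 2 - b 2 * c 1) - a 1 * (b 0 * c 2 - b 2 * c 0) + a 2 * (b 0 * c 1 - b 1 * c 0)

/-- The side of `p` with respect to the plane through `t` and the third coordinate axis. -/
def side (t p : Fin 3 → ℝ) : ℝ := p 0 * t 1 - p 1 * t 0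

open Classical in
/-- The signed crossing of the segment from `a` to `b` with the ray from `t` along the third
coordinate axis. -/
def crossing (t a b : Fin 3 → ℝ) : ℝ :=
  (if 0 < side t a ∧ side t b < 0 ∧ 0 < triple a b t then 1 else 0) -
    (if 0 < side t b ∧ side t a < 0 ∧ triple a b t < 0 then 1 else 0)

/-- The open simplicial cone spanned by a positively oriented basis. -/
def openCone (a b c : Fin 3 → ℝ) : Set (Fin 3 → ℝ) :=
  {t | 0 < triple b c t ∧ 0 < triple c a t ∧ 0 < triple a b t}

theorem crossing_swap (t a b : Fin 3 → ℝ) : crossing t b a = -crossing t a b := by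
  have h : triple b a t = -triple a b t := by unfold triple; ring
  simp only [crossing, h, neg_pos, neg_lt_zero]
  ring

-- The sign combinatorics of ray casting. Here `p, q, r` are, up to a positive factor, the
-- coordinates of `t` in the basis `a, b, c`, and `x, y, z` are the sides of the three vertices. The
-- linear relation excludes the inconsistent sign patterns, and `hn` excludes `t` lying in the
-- opposite cone; the identity is checked on every remaining pattern.
open Classical in
theorem indicator_of_signs {p q r x y z : ℝ} (hp : p ≠ 0) (hq : q ≠ 0) (hr : r ≠ 0)
    (hx : x ≠ 0) (hy : y ≠ 0) (hz : z ≠ 0) (h : p * x + q * y + r * z = 0)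
    (hn : ¬(p < 0 ∧ q < 0 ∧ r < 0)) :
    (if 0 < p ∧ 0 < q ∧ 0 < r then (1 : ℝ) else 0) =
      ((if 0 < x ∧ y < 0 ∧ 0 < r then 1 else 0) - (if 0 < y ∧ x < 0 ∧ r < 0 then 1 else 0)) +
      ((if 0 < y ∧ z < 0 ∧ 0 < p then 1 else 0) - (if 0 < z ∧ y < 0 ∧ p < 0 then 1 else 0)) +
      ((if 0 < z ∧ x < 0 ∧ 0 < q then 1 else 0) - (if 0 < x ∧ z < 0 ∧ q < 0 then 1 else 0)) := by
  rcases lt_or_gt_of_ne hp with hp | hp <;> rcases lt_or_gt_of_ne hq with hq | hq <;>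
    rcases lt_or_gt_of_ne hr with hr | hr <;> rcases lt_or_gt_of_ne hx with hx | hx <;>
    rcases lt_or_gt_of_ne hy with hy | hy <;> rcases lt_or_gt_of_ne hz with hz | hz <;>
    simp only [hp, hq, hr, hx, hy, hz, hp.not_gt, hq.not_gt, hr.not_gt, hx.not_gt, hy.not_gt,
      hz.not_gt, and_true, and_false, if_true, if_false, and_self,
      not_true_eq_false] at hn ⊢ <;>
    first
    | (norm_num; done)
    | (exfalso; nlinarith)

open Classical in
/-- The indicator function of a cone is the crossing number of its boundary. -/
theorem indicator_openCone {a b c t : Fin 3 → ℝ} (ha : ∀ i, 0 < a i) (hb : ∀ i, 0 < b i)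
    (hc : ∀ i, 0 < c i) (ht : ∀ i, 0 < t i) (habc : 0 < triple a b c)
    (hp : triple b c t ≠ 0) (hq : triple c a t ≠ 0) (hr : triple a b t ≠ 0)
    (hx : side t a ≠ 0) (hy : side t b ≠ 0) (hz : side t c ≠ 0) :
    (if t ∈ openCone a b c then (1 : ℝ) else 0) =
      crossing t a b + crossing t b c + crossing t c a := by
  -- Cramer's rule writes `triple a b c • t` as a combination of `a, b, c`. Applying `side t`, which
  -- kills `t`, gives `h1`; taking first coordinates gives `h2`.
  have h1 : triple b c t * side t a + triple c a t * side t b + triple a b t * side t c = 0 := by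
    unfold triple side; ring
  have h2 : triple b c t * a 0 + triple c a t * b 0 + triple a b t * c 0 = triple a b c * t 0 := by
    unfold triple; ring
  have hn : ¬(triple b c t < 0 ∧ triple c a t < 0 ∧ triple a b t < 0) := by
    rintro ⟨n1, n2, n3⟩
    have := mul_pos habc (ht 0)
    have := mul_neg_of_neg_of_pos n1 (ha 0)
    have := mul_neg_of_neg_of_pos n2 (hb 0)
    have := mul_neg_of_neg_of_pos n3 (hc 0)
    linarith
  refine Eq.trans ?_ (indicator_of_signs hp hq hr hx hy hz h1 hn)
  by_cases hmem : t ∈ openCone a b c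
  · rw [if_pos hmem]
    exact (if_pos hmem).symm
  · rw [if_neg hmem]
    exact (if_neg hmem).symm

theorem triple_mul (g a b c : Fin 3 → ℝ) :
    triple (g * a) (g * b) (g * c) = g 0 * g 1 * g 2 * triple a b c := by
  simp only [triple, Pi.mul_apply]; ring

theorem side_mul (g t p : Fin 3 → ℝ) : side (g * t) (g * p) = g 0 * g 1 * side t p := by
  simp only [side, Pi.mul_apply]; ring

/-- Positive diagonal scalings preserve orientation and the direction of a coordinate axis. This is
why the ray is cast along an axis: crossing numbers become equivariant under totally positive units.
-/
theorem crossing_mul {g : Fin 3 → ℝ} (hg : ∀ i, 0 < g i) (t a b : Fin 3 → ℝ) :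
    crossing (g * t) (g * a) (g * b) = crossing t a b := by
  have h01 : 0 < g 0 * g 1 := mul_pos (hg 0) (hg 1)
  have h012 : 0 < g 0 * g 1 * g 2 := mul_pos h01 (hg 2)
  have hneg : ∀ {x y : ℝ}, 0 < x → (x * y < 0 ↔ y < 0) := fun hx => by
    rw [← neg_pos, ← mul_neg, mul_pos_iff_of_pos_left hx, neg_pos]
  simp only [crossing, triple_mul, side_mul, mul_pos_iff_of_pos_left h01,
    mul_pos_iff_of_pos_left h012, hneg h01, hneg h012]

/-! ### The action of the totally positive units -/

/-- The conjugates of the totally positive unit `η² - η`. -/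
def unitOne : Fin 3 → ℝ :=
  ![eta 0 ^ 2 - eta 0, -2 * eta 0 ^ 2 - eta 0 + 5, eta 0 ^ 2 + 2 * eta 0 + 1]

/-- The conjugates of the totally positive unit `-2η² - η + 5`. -/
def unitTwo : Fin 3 → ℝ :=
  ![-2 * eta 0 ^ 2 - eta 0 + 5, eta 0 ^ 2 + 2 * eta 0 + 1, eta 0 ^ 2 - eta 0]

theorem unitOne_zero_pos : 0 < unitOne 0 := by
  have h1 := eta_zero_gt
  simp [unitOne]; nlinarith

/-- Here `zero` and `one` in the name are coordinate indices. The strict order of the conjugates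
makes powers of the unit push points in a definite direction. -/
theorem unitOne_zero_lt_one : unitOne 0 < unitOne 1 := by
  have h1 := eta_zero_gt
  have h2 := eta_zero_lt
  simp [unitOne]; nlinarith

theorem unitOne_one_lt_two : unitOne 1 < unitOne 2 := by
  have h1 := eta_zero_gt
  have h2 := eta_zero_lt
  simp [unitOne]; nlinarith

theorem unitOne_pos (i : Fin 3) : 0 < unitOne i := by
  have h0 := unitOne_zero_pos
  have h1 := unitOne_zero_lt_one
  have h2 := unitOne_one_lt_two
  fin_cases i
  · exact h0
  · exact h0.trans h1
  · exact (h0.trans h1).trans h2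

/-- The second unit is a Galois conjugate of the first, so only three positive reals occur in all
estimates. -/
theorem unitTwo_eq : unitTwo = ![unitOne 1, unitOne 2, unitOne 0] := rfl

theorem unitTwo_pos (i : Fin 3) : 0 < unitTwo i := by
  rw [unitTwo_eq]
  fin_cases i
  · exact unitOne_pos 1
  · exact unitOne_pos 2
  · exact unitOne_pos 0

theorem prod_unitOne : unitOne 0 * unitOne 1 * unitOne 2 = 1 := by
  have h := eta_zero_pow_three
  simp only [unitOne, Matrix.cons_val]
  generalize eta 0 = x at h ⊢
  grind

/-- The conjugates of the products of powers of the two units. -/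
def scale (p : ℤ × ℤ) : Fin 3 → ℝ := fun n => unitOne n ^ p.1 * unitTwo n ^ p.2

theorem scale_pos (p : ℤ × ℤ) (n : Fin 3) : 0 < scale p n :=
  mul_pos (zpow_pos (unitOne_pos n) _) (zpow_pos (unitTwo_pos n) _)

theorem scale_add (p q : ℤ × ℤ) : scale (p + q) = scale p * scale q := by
  ext n
  simp only [scale, Prod.fst_add, Prod.snd_add, Pi.mul_apply,
    zpow_add₀ (unitOne_pos n).ne', zpow_add₀ (unitTwo_pos n).ne']
  ring

@[simp] theorem scale_zero : scale 0 = 1 := by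
  ext n; simp [scale]

theorem scale_add_mul (p q : ℤ × ℤ) (t : Fin 3 → ℝ) : scale p * (scale q * t) = scale (p + q) * t := by
  rw [scale_add, mul_assoc]

theorem scale_one_zero : scale (1, 0) = unitOne := by
  ext n; simp [scale]

theorem scale_zero_one : scale (0, 1) = unitTwo := by
  ext n; simp [scale]

theorem prod_scale (p : ℤ × ℤ) : ∏ n, scale p n = 1 := by
  have h2 : unitTwo 0 * unitTwo 1 * unitTwo 2 = 1 := by
    rw [← prod_unitOne, unitTwo_eq]; simp; ring
  rw [Finset.prod_congr rfl fun n _ => rfl]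
  simp only [scale]
  rw [Finset.prod_mul_distrib, Finset.prod_zpow, Finset.prod_zpow, Fin.prod_univ_three,
    Fin.prod_univ_three, prod_unitOne, h2]
  simp

/-- With the next two lemmas: vertices 0, 1, 3, 2 are the corners of a quadrilateral with opposite
sides identified by the units. -/
theorem vertex_one_eq : vertex 1 = scale (1, 0) * vertex 0 := by
  have h := eta_zero_pow_three
  rw [scale_one_zero, vertex_one, vertex_zero]
  ext i
  fin_cases i <;> simp [unitOne] <;> generalize eta 0 = x at h ⊢
  all_goals grind

theorem vertex_two_eq : vertex 2 = scale (0, 1) * vertex 0 := by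
  have h := eta_zero_pow_three
  rw [scale_zero_one, vertex_two, vertex_zero]
  ext i
  fin_cases i <;> simp [unitTwo] <;> generalize eta 0 = x at h ⊢
  all_goals grind

theorem vertex_three_eq : vertex 3 = scale (1, 1) * vertex 0 := by
  have h := eta_zero_pow_three
  have e : ((1, 1) : ℤ × ℤ) = (1, 0) + (0, 1) := rfl
  rw [e, ← scale_add_mul, ← vertex_two_eq, scale_one_zero, vertex_three, vertex_two]
  ext i
  fin_cases i <;> simp [unitOne] <;> generalize eta 0 = x at h ⊢
  all_goals grind

/-- The value is `det I_m = 1` times the determinant of the conjugates of `w*`, that is `1/√49`. Its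
sign orients the cells for ray casting, and its size is the Jacobian behind the factor `7` in the
formula. -/
theorem triple_cone (m : Fin 4) : triple (vertex (coneIndex m 0)) (vertex (coneIndex m 1))
    (vertex (coneIndex m 2)) = 1 / 7 := by
  have h := eta_zero_pow_three
  fin_cases m <;> simp [coneIndex, triple, vertex_zero, vertex_one, vertex_two, vertex_three, vertex_four] <;>
    generalize eta 0 = x at h ⊢
  all_goals grind

end ConicalZeta

namespace ConicalZeta

open Filter Topology

/-! ### Counting the cones containing a point -/

/-- The open cone spanned by the columns of the `m`-th cone matrix. -/
def cell (m : Fin 4) : Set (Fin 3 → ℝ) :=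
  openCone (vertex (coneIndex m 0)) (vertex (coneIndex m 1)) (vertex (coneIndex m 2))

/-- Points avoiding all the walls. -/
structure Generic (t : Fin 3 → ℝ) : Prop where
  side_ne : ∀ p k, side (scale p * t) (vertex k) ≠ 0
  triple_ne : ∀ p m,
    triple (vertex (coneIndex m 1)) (vertex (coneIndex m 2)) (scale p * t) ≠ 0 ∧
    triple (vertex (coneIndex m 2)) (vertex (coneIndex m 0)) (scale p * t) ≠ 0 ∧
    triple (vertex (coneIndex m 0)) (vertex (coneIndex m 1)) (scale p * t) ≠ 0

theorem Generic.scale {t : Fin 3 → ℝ} (h : Generic t) (p : ℤ × ℤ) : Generic (scale p * t) where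
  side_ne q k := by rw [scale_add_mul]; exact h.side_ne _ k
  triple_ne q m := by rw [scale_add_mul]; exact h.triple_ne _ m

theorem scale_mul_pos {t : Fin 3 → ℝ} (ht : ∀ i, 0 < t i) (p : ℤ × ℤ) (i : Fin 3) :
    0 < (scale p * t) i := mul_pos (scale_pos p i) (ht i)

open Classical in
/-- The number of cells containing a point. -/
def cellCount (t : Fin 3 → ℝ) : ℝ := ∑ m, if t ∈ cell m then 1 else 0

theorem cellCount_nonneg (t : Fin 3 → ℝ) : 0 ≤ cellCount t :=
  Finset.sum_nonneg fun m _ => by split_ifs <;> norm_num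

/-- Crossing number of the first side of the fundamental quadrilateral. -/
def rowCrossing (t : Fin 3 → ℝ) : ℝ := crossing t (vertex 0) (vertex 1)

/-- Crossing number of the second side of the fundamental quadrilateral. -/
def columnCrossing (t : Fin 3 → ℝ) : ℝ := crossing t (vertex 0) (vertex 2)

theorem crossing_scale (p : ℤ × ℤ) (t a b : Fin 3 → ℝ) :
    crossing t (scale p * a) (scale p * b) = crossing (scale (-p) * t) a b := by
  rw [← crossing_mul (scale_pos p) (scale (-p) * t), scale_add_mul]
  simp

/-- The edges 03, 04, 34 and 14 are each traversed in both directions and cancel. What remains is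
the boundary 0→2→3→1→0, in which 2→3 is the `ε₂`-translate of 0→1 and 1→3 the `ε₁`-translate of 0→2.
-/
theorem cellCount_eq {t : Fin 3 → ℝ} (ht : ∀ i, 0 < t i) (hg : Generic t) :
    cellCount t = columnCrossing t - columnCrossing (scale (-1, 0) * t)
      - (rowCrossing t - rowCrossing (scale (0, -1) * t)) := by
  have hs : ∀ k, side t (vertex k) ≠ 0 := fun k => by simpa using hg.side_ne 0 k
  have hd := hg.triple_ne 0
  simp only [scale_zero, one_mul] at hd
  have key : ∀ m, (open Classical in if t ∈ cell m then (1 : ℝ) else 0) =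
      crossing t (vertex (coneIndex m 0)) (vertex (coneIndex m 1)) +
      crossing t (vertex (coneIndex m 1)) (vertex (coneIndex m 2)) +
      crossing t (vertex (coneIndex m 2)) (vertex (coneIndex m 0)) := fun m =>
    indicator_openCone (vertex_pos _) (vertex_pos _) (vertex_pos _) ht
      (by rw [triple_cone]; norm_num) (hd m).1 (hd m).2.1 (hd m).2.2 (hs _) (hs _) (hs _)
  have h1 : crossing t (vertex 1) (vertex 3) = columnCrossing (scale (-1, 0) * t) := by
    rw [vertex_three_eq, vertex_one_eq, columnCrossing, show ((-1, 0) : ℤ × ℤ) = -(1, 0) from rfl,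
      ← crossing_scale, vertex_two_eq, scale_add_mul]
    rfl
  have h2 : crossing t (vertex 2) (vertex 3) = rowCrossing (scale (0, -1) * t) := by
    rw [vertex_three_eq, vertex_two_eq, rowCrossing, show ((0, -1) : ℤ × ℤ) = -(0, 1) from rfl,
      ← crossing_scale, vertex_one_eq, scale_add_mul]
    rfl
  simp only [cellCount, key, Fin.sum_univ_four, coneIndex, Matrix.cons_val]
  rw [← h1, ← h2, crossing_swap t (vertex 0) (vertex 3), crossing_swap t (vertex 0) (vertex 4),
    crossing_swap t (vertex 3) (vertex 4), crossing_swap t (vertex 0) (vertex 1),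
    crossing_swap t (vertex 1) (vertex 3), crossing_swap t (vertex 1) (vertex 4), rowCrossing,
    columnCrossing]
  ring

/-! ### Summation over the unit group -/

theorem hasSum_nat_telescope {f : ℕ → ℝ} {A : ℝ} (h : ∀ᶠ n in atTop, f n = A) :
    HasSum (fun n => f (n + 1) - f n) (A - f 0) := by
  obtain ⟨N, hN⟩ := eventually_atTop.1 h
  have := hasSum_sum_of_ne_finset_zero (f := fun n => f (n + 1) - f n) (s := Finset.range N)
    (L := SummationFilter.unconditional ℕ) (fun n hn => by
      rw [Finset.mem_range, not_lt] at hn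
      rw [hN n hn, hN (n + 1) (by omega), sub_self])
  rwa [Finset.sum_range_sub, hN N le_rfl] at this

theorem hasSum_int_telescope {f : ℤ → ℝ} {A B : ℝ} (h : ∀ᶠ n in atTop, f n = A)
    (h' : ∀ᶠ n in atBot, f n = B) : HasSum (fun n => f (n + 1) - f n) (A - B) := by
  have h1 := hasSum_nat_telescope (f := fun n : ℕ => f n)
    (tendsto_natCast_atTop_atTop.eventually h)
  have h2 := (hasSum_nat_telescope (f := fun n : ℕ => f (-n))
    ((tendsto_neg_atTop_atBot.comp tendsto_natCast_atTop_atTop).eventually h')).neg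
  have := HasSum.of_nat_of_neg_add_one (f := fun n => f (n + 1) - f n) (m := A - f 0)
    (m' := -(B - f 0)) (by simpa using h1) (by
      have e : (fun n : ℕ => f (-((n : ℤ) + 1) + 1) - f (-((n : ℤ) + 1))) =
          fun n : ℕ => -(f (-((n + 1 : ℕ) : ℤ)) - f (-(n : ℤ))) := by
        funext n
        push_cast
        rw [show (-((n : ℤ) + 1) + 1) = -n by ring]
        ring
      rw [e]
      simpa using h2)
  convert this using 1
  ring

/-- The ratio of the first two coordinates. -/
theorem unitOne_ratio_lt : 1 < unitOne 1 / unitOne 0 :=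
  (one_lt_div unitOne_zero_pos).2 unitOne_zero_lt_one

theorem side_vertex_scale (p : ℤ × ℤ) (t : Fin 3 → ℝ) (k : Fin 5) :
    side (scale p * t) (vertex k) =
      vertex k 0 * (scale p 1 * t 1) - vertex k 1 * (scale p 0 * t 0) := rfl

theorem eventually_lt_zpow {x : ℝ} (hx : 1 < x) (B : ℝ) : ∀ᶠ i : ℤ in atTop, B < x ^ i := by
  obtain ⟨n, hn⟩ := pow_unbounded_of_one_lt B hx
  filter_upwards [eventually_ge_atTop (n : ℤ)] with i hi
  exact hn.trans_le (by rw [← zpow_natCast]; exact zpow_le_zpow_right₀ hx.le hi)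

/-- Far along the first unit, all vertices lie on the same side. -/
theorem side_neg_iff (k : Fin 5) {t : Fin 3 → ℝ} (ht : ∀ i, 0 < t i) (i : ℤ) :
    side (scale (i, 0) * t) (vertex k) < 0 ↔
      (unitOne 1 / unitOne 0) ^ i < vertex k 1 * t 0 / (vertex k 0 * t 1) := by
  have h0 := unitOne_pos 0
  have h1 := unitOne_pos 1
  rw [side_vertex_scale, sub_neg, lt_div_iff₀ (mul_pos (vertex_pos _ _) (ht 1)), div_zpow,
    div_mul_eq_mul_div, div_lt_iff₀ (zpow_pos h0 _)]
  simp only [scale, zpow_zero, mul_one]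
  constructor <;> intro h <;> linarith

theorem side_pos_iff (k : Fin 5) {t : Fin 3 → ℝ} (ht : ∀ i, 0 < t i) (i : ℤ) :
    0 < side (scale (i, 0) * t) (vertex k) ↔
      vertex k 1 * t 0 / (vertex k 0 * t 1) < (unitOne 1 / unitOne 0) ^ i := by
  have h0 := unitOne_pos 0
  have h1 := unitOne_pos 1
  rw [side_vertex_scale, sub_pos, div_lt_iff₀ (mul_pos (vertex_pos _ _) (ht 1)), div_zpow,
    div_mul_eq_mul_div, lt_div_iff₀ (zpow_pos h0 _)]
  simp only [scale, zpow_zero, mul_one]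
  constructor <;> intro h <;> linarith

theorem crossing_eq_zero_of_pos {t a b : Fin 3 → ℝ} (ha : 0 < side t a) (hb : 0 < side t b) :
    crossing t a b = 0 := by
  simp [crossing, ha.not_gt, hb.not_gt]

theorem crossing_eq_zero_of_neg {t a b : Fin 3 → ℝ} (ha : side t a < 0) (hb : side t b < 0) :
    crossing t a b = 0 := by
  simp [crossing, ha.not_gt, hb.not_gt]

theorem eventually_side_pos (k : Fin 5) {t : Fin 3 → ℝ} (ht : ∀ i, 0 < t i) :
    ∀ᶠ i : ℤ in atTop, 0 < side (scale (i, 0) * t) (vertex k) := by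
  simp only [side_pos_iff k ht]
  exact eventually_lt_zpow unitOne_ratio_lt _

theorem eventually_side_neg (k : Fin 5) {t : Fin 3 → ℝ} (ht : ∀ i, 0 < t i) :
    ∀ᶠ i : ℤ in atBot, side (scale (i, 0) * t) (vertex k) < 0 := by
  simp only [side_neg_iff k ht]
  have h : 0 < vertex k 1 * t 0 / (vertex k 0 * t 1) :=
    div_pos (mul_pos (vertex_pos _ _) (ht 0)) (mul_pos (vertex_pos _ _) (ht 1))
  have := eventually_lt_zpow unitOne_ratio_lt
    (vertex k 1 * t 0 / (vertex k 0 * t 1))⁻¹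
  filter_upwards [tendsto_neg_atBot_atTop.eventually this] with i hi
  rw [zpow_neg] at hi
  exact (inv_lt_inv₀ h (zpow_pos (zero_lt_one.trans unitOne_ratio_lt) _)).1 hi

/-- Large powers of `ε₁` in either direction put both ends of the edge on the same side, so the
telescoping sum has boundary value zero at both ends. -/
theorem hasSum_columnCrossing {t : Fin 3 → ℝ} (ht : ∀ i, 0 < t i) :
    HasSum (fun i : ℤ => columnCrossing (scale (i, 0) * t) -
      columnCrossing (scale (-1, 0) * (scale (i, 0) * t))) 0 := by
  have h1 : ∀ᶠ i : ℤ in atTop, columnCrossing (scale (i, 0) * t) = 0 := by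
    filter_upwards [eventually_side_pos 0 ht, eventually_side_pos 2 ht] with i h0 h2
    exact crossing_eq_zero_of_pos h0 h2
  have h2 : ∀ᶠ i : ℤ in atBot, columnCrossing (scale (i, 0) * t) = 0 := by
    filter_upwards [eventually_side_neg 0 ht, eventually_side_neg 2 ht] with i h0 h2
    exact crossing_eq_zero_of_neg h0 h2
  have h := hasSum_int_telescope h1 h2
  rw [sub_zero] at h
  convert (Equiv.subRight (1 : ℤ)).hasSum_iff.2 h using 2 with i
  simp [scale_add_mul, sub_eq_neg_add]

end ConicalZeta

/-! ### Row crossings and the tiling of the octant -/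

namespace ConicalZeta

open Filter Topology

/-- Each row of translated edges crosses the plane through `t` exactly once. -/
theorem exists_row_crossing {t : Fin 3 → ℝ} (ht : ∀ i, 0 < t i) (hg : Generic t) :
    ∃ n : ℤ, 0 < side (scale (n, 0) * t) (vertex 0) ∧ side (scale (n, 0) * t) (vertex 1) < 0 ∧
      ∀ i ≠ n, rowCrossing (scale (i, 0) * t) = 0 := by
  have hx := unitOne_ratio_lt
  have h0 := unitOne_pos 0
  have hp := fun i => side_pos_iff 0 ht i
  have hn := fun i => side_neg_iff 1 ht i
  have hn0 := fun i => side_neg_iff 0 ht i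
  have hp1 := fun i => side_pos_iff 1 ht i
  -- The threshold for vertex 1 is `x` times the threshold `q` for vertex 0. The translated edges
  -- thus occupy adjacent intervals, and the crossing index is the unique `n` with `q < x ^ n < x *
  -- q`.
  have e : vertex 1 1 * t 0 / (vertex 1 0 * t 1) =
      unitOne 1 / unitOne 0 * (vertex 0 1 * t 0 / (vertex 0 0 * t 1)) := by
    rw [vertex_one_eq, scale_one_zero]
    simp only [Pi.mul_apply]
    have := vertex_pos 0 0
    have := ht 1
    field_simp
  rw [e] at hn hp1
  have hq : 0 < vertex 0 1 * t 0 / (vertex 0 0 * t 1) :=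
    div_pos (mul_pos (vertex_pos _ _) (ht 0)) (mul_pos (vertex_pos _ _) (ht 1))
  set q := vertex 0 1 * t 0 / (vertex 0 0 * t 1)
  set x := unitOne 1 / unitOne 0
  have hx0 : 0 < x := zero_lt_one.trans hx
  obtain ⟨m, hm1, hm2⟩ := exists_mem_Ico_zpow hq hx
  have hm3 : x ^ (m + 1) ≤ x * q := by
    rw [zpow_add_one₀ hx0.ne', mul_comm]
    exact mul_le_mul_of_nonneg_left hm1 hx0.le
  refine ⟨m + 1, (hp _).2 hm2, (hn _).2 ?_, fun i hi => ?_⟩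
  -- Equality would put vertex 1 on the plane through the point and the third axis, against
  -- genericity.
  · refine lt_of_le_of_ne hm3 fun h => hg.side_ne (m + 1, 0) 1 ?_
    refine le_antisymm (not_lt.1 fun h' => ?_) (not_lt.1 fun h' => ?_)
    · exact absurd ((hp1 _).1 h') (by rw [h]; exact lt_irrefl _)
    · exact absurd ((hn _).1 h') (by rw [h]; exact lt_irrefl _)
  · rcases lt_or_gt_of_ne hi with hi | hi
    · have h1 : x ^ i ≤ x ^ m := zpow_le_zpow_right₀ hx.le (by omega)
      refine crossing_eq_zero_of_neg (lt_of_le_of_ne ?_ (hg.side_ne _ _)) ((hn _).2 ?_)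
      · refine not_lt.1 fun h => ?_
        have := (hp _).1 h
        linarith
      · nlinarith
    · have h1 : x ^ (m + 1 + 1) ≤ x ^ i := zpow_le_zpow_right₀ hx.le (by omega)
      have h2 : x * q < x ^ (m + 1 + 1) := by
        rw [zpow_add_one₀ hx0.ne' (m + 1), mul_comm]
        exact mul_lt_mul_of_pos_right hm2 hx0
      refine crossing_eq_zero_of_pos ((hp _).2 ?_) ((hp1 _).2 (h2.trans_le h1))
      nlinarith

theorem rowCrossing_eq {t : Fin 3 → ℝ} (h0 : 0 < side t (vertex 0)) (h1 : side t (vertex 1) < 0) :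
    rowCrossing t = open Classical in if 0 < triple (vertex 0) (vertex 1) t then 1 else 0 := by
  simp [rowCrossing, crossing, h0, h1, h0.not_gt]

theorem triple_row_sign {t : Fin 3 → ℝ} (h0 : 0 < side t (vertex 0))
    (h1 : side t (vertex 1) < 0) :
    (2 * t 1 < t 2 → 0 < triple (vertex 0) (vertex 1) t) ∧
      (t 2 < 1 / 10 * t 1 → triple (vertex 0) (vertex 1) t < 0) := by
  have hM : 0 < vertex 0 0 * vertex 1 1 - vertex 0 1 * vertex 1 0 := by
    have h := mul_pos (mul_pos (vertex_pos 0 0) (vertex_pos 0 1)) (sub_pos.2 unitOne_zero_lt_one)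
    rw [vertex_one_eq, scale_one_zero]
    simp only [Pi.mul_apply]
    linarith
  have e1 : (vertex 0 0 * vertex 1 1 - vertex 0 1 * vertex 1 0) * t 1 =
      -side t (vertex 1) * vertex 0 1 + side t (vertex 0) * vertex 1 1 := by
    unfold side; ring
  have e2 : triple (vertex 0) (vertex 1) t =
      (vertex 0 0 * vertex 1 1 - vertex 0 1 * vertex 1 0) * t 2
      - (-side t (vertex 1) * vertex 0 2 + side t (vertex 0) * vertex 1 2) := by
    unfold side triple; ring
  have hl := eta_zero_gt
  have hu := eta_zero_lt
  have b1 : vertex 0 2 < 2 * vertex 0 1 := by rw [vertex_zero]; simp; nlinarith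
  have b2 : vertex 1 2 < 2 * vertex 1 1 := by rw [vertex_one]; simp; nlinarith
  have b3 : 1 / 10 * vertex 0 1 < vertex 0 2 := by rw [vertex_zero]; simp; nlinarith
  have b4 : 1 / 10 * vertex 1 1 < vertex 1 2 := by rw [vertex_one]; simp; nlinarith
  have c1 := mul_lt_mul_of_pos_left b1 (neg_pos.2 h1)
  have c2 := mul_lt_mul_of_pos_left b2 h0
  have c3 := mul_lt_mul_of_pos_left b3 (neg_pos.2 h1)
  have c4 := mul_lt_mul_of_pos_left b4 h0
  rw [e2]
  constructor <;> intro h <;> have := mul_lt_mul_of_pos_left h hM <;> linarith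

theorem log_scale_mul {t : Fin 3 → ℝ} (ht : ∀ i, 0 < t i) (i j : ℤ) (n : Fin 3) :
    Real.log ((scale (i, j) * t) n) =
      i * Real.log (unitOne n) + j * Real.log (unitTwo n) + Real.log (t n) := by
  have h1 := unitOne_pos n
  have h2 := unitTwo_pos n
  simp only [Pi.mul_apply, scale]
  rw [Real.log_mul (by positivity) (ht n).ne', Real.log_mul (by positivity) (by positivity),
    Real.log_zpow, Real.log_zpow]

/-- In logarithmic coordinates the units act by translations. The linear form in `key` is invariant
under `ε₁` and drops by `κ` under `ε₂`. Since the edge bounds `log t₀ - log t₁`, the difference `log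
t₂ - log t₁` is controlled by `j` alone, uniformly in `i`. -/
theorem exists_height_bounds {t : Fin 3 → ℝ} (ht : ∀ i, 0 < t i) :
    ∃ d κ K L : ℝ, 0 < d ∧ 0 < κ ∧ ∀ i j : ℤ, 0 < side (scale (i, j) * t) (vertex 0) →
      side (scale (i, j) * t) (vertex 1) < 0 →
      K - j * κ < d * (Real.log ((scale (i, j) * t) 2) - Real.log ((scale (i, j) * t) 1)) ∧
      d * (Real.log ((scale (i, j) * t) 2) - Real.log ((scale (i, j) * t) 1)) < L - j * κ := by
  have hab := Real.log_lt_log (unitOne_pos 0) unitOne_zero_lt_one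
  have hbc := Real.log_lt_log (unitOne_pos 1) unitOne_one_lt_two
  have hs := fun i j => log_scale_mul ht i j
  simp only [unitTwo_eq] at hs
  set la := Real.log (unitOne 0)
  set lb := Real.log (unitOne 1)
  set lc := Real.log (unitOne 2)
  set Q := (lb - la) * (Real.log (t 2) - Real.log (t 1)) +
    (lc - lb) * (Real.log (t 0) - Real.log (t 1))
  refine ⟨lb - la, (lb - la) * (lc - la) + (lc - lb) ^ 2,
    Q - (lc - lb) * (Real.log (vertex 0 0) - Real.log (vertex 0 1)),
    Q - (lc - lb) * (Real.log (vertex 1 0) - Real.log (vertex 1 1)), sub_pos.2 hab,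
    add_pos (mul_pos (sub_pos.2 hab) (by linarith)) (pow_pos (sub_pos.2 hbc) 2),
    fun i j h0 h1 => ?_⟩
  have p := fun n => scale_mul_pos ht (i, j) n
  have key : (lb - la) * (Real.log ((scale (i, j) * t) 2) - Real.log ((scale (i, j) * t) 1)) +
      (lc - lb) * (Real.log ((scale (i, j) * t) 0) - Real.log ((scale (i, j) * t) 1)) =
      Q - j * ((lb - la) * (lc - la) + (lc - lb) ^ 2) := by
    rw [hs, hs, hs]
    simp only [Matrix.cons_val, Q]
    ring
  have y1 : Real.log ((scale (i, j) * t) 0) - Real.log ((scale (i, j) * t) 1) <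
      Real.log (vertex 0 0) - Real.log (vertex 0 1) := by
    have := Real.log_lt_log (mul_pos (vertex_pos 0 1) (p 0)) (sub_pos.1 h0)
    rw [Real.log_mul (vertex_pos _ _).ne' (p 0).ne',
      Real.log_mul (vertex_pos _ _).ne' (p 1).ne'] at this
    linarith
  have y2 : Real.log (vertex 1 0) - Real.log (vertex 1 1) <
      Real.log ((scale (i, j) * t) 0) - Real.log ((scale (i, j) * t) 1) := by
    have := Real.log_lt_log (mul_pos (vertex_pos 1 0) (p 1)) (sub_neg.1 h1)
    rw [Real.log_mul (vertex_pos _ _).ne' (p 0).ne',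
      Real.log_mul (vertex_pos _ _).ne' (p 1).ne'] at this
    linarith
  have z1 := mul_lt_mul_of_pos_left y1 (sub_pos.2 hbc)
  have z2 := mul_lt_mul_of_pos_left y2 (sub_pos.2 hbc)
  constructor <;> linarith

/-- Uniformity in `i` matters because the position of the crossing edge within a row depends on `j`.
-/
theorem eventually_above {t : Fin 3 → ℝ} (ht : ∀ i, 0 < t i) :
    ∀ᶠ j : ℤ in atBot, ∀ i : ℤ, 0 < side (scale (i, j) * t) (vertex 0) →
      side (scale (i, j) * t) (vertex 1) < 0 →
      0 < triple (vertex 0) (vertex 1) (scale (i, j) * t) := by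
  obtain ⟨d, κ, K, L, hd, hκ, h⟩ := exists_height_bounds ht
  have e : ∀ᶠ j : ℤ in atBot, (j : ℝ) < (K - d * Real.log 2) / κ :=
    (tendsto_intCast_atBot_iff.2 tendsto_id).eventually_lt_atBot _
  filter_upwards [e] with j hj i h0 h1
  have p := fun n => scale_mul_pos ht (i, j) n
  refine (triple_row_sign h0 h1).1 ?_
  have hh := (h i j h0 h1).1
  rw [lt_div_iff₀ hκ] at hj
  have : d * Real.log 2 < d * (Real.log ((scale (i, j) * t) 2) - Real.log ((scale (i, j) * t) 1)) := by
    linarith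
  have := lt_of_mul_lt_mul_left this hd.le
  rw [← Real.log_lt_log_iff (mul_pos two_pos (p 1)) (p 2), Real.log_mul two_ne_zero (p 1).ne']
  linarith

theorem eventually_below {t : Fin 3 → ℝ} (ht : ∀ i, 0 < t i) :
    ∀ᶠ j : ℤ in atTop, ∀ i : ℤ, 0 < side (scale (i, j) * t) (vertex 0) →
      side (scale (i, j) * t) (vertex 1) < 0 →
      triple (vertex 0) (vertex 1) (scale (i, j) * t) < 0 := by
  obtain ⟨d, κ, K, L, hd, hκ, h⟩ := exists_height_bounds ht
  have e : ∀ᶠ j : ℤ in atTop, (L - d * Real.log (1 / 10)) / κ < j :=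
    (tendsto_intCast_atTop_atTop (R := ℝ)).eventually_gt_atTop _
  filter_upwards [e] with j hj i h0 h1
  have p := fun n => scale_mul_pos ht (i, j) n
  refine (triple_row_sign h0 h1).2 ?_
  have hh := (h i j h0 h1).2
  rw [div_lt_iff₀ hκ] at hj
  have : d * (Real.log ((scale (i, j) * t) 2) - Real.log ((scale (i, j) * t) 1)) <
      d * Real.log (1 / 10) := by
    linarith
  have := lt_of_mul_lt_mul_left this hd.le
  rw [← Real.log_lt_log_iff (p 2) (mul_pos (by norm_num) (p 1)),
    Real.log_mul (by norm_num) (p 1).ne']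
  linarith

/-- The translates of the four cells under the group generated by the two units tile the positive
octant. -/
theorem tsum_cellCount {t : Fin 3 → ℝ} (ht : ∀ i, 0 < t i) (hg : Generic t) :
    ∑' p : ℤ × ℤ, ENNReal.ofReal (cellCount (scale p * t)) = 1 := by
  have hrow : ∀ j : ℤ, ∃ n : ℤ, 0 < side (scale (n, j) * t) (vertex 0) ∧
      side (scale (n, j) * t) (vertex 1) < 0 ∧
      ∀ i ≠ n, rowCrossing (scale (i, j) * t) = 0 := fun j => by
    simpa [scale_add_mul] using exists_row_crossing (scale_mul_pos ht (0, j)) (hg.scale (0, j))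
  choose n h0 h1 hn using hrow
  set R : ℤ → ℝ := fun j => rowCrossing (scale (n j, j) * t)
  have hR : ∀ j, HasSum (fun i => rowCrossing (scale (i, j) * t)) (R j) := fun j =>
    hasSum_single (n j) (hn j)
  have htop : ∀ᶠ j in atTop, R j = 0 := by
    filter_upwards [eventually_below ht] with j hj
    simp [R, rowCrossing_eq (h0 j) (h1 j), (hj _ (h0 j) (h1 j)).not_gt]
  have hbot : ∀ᶠ j in atBot, R j = 1 := by
    filter_upwards [eventually_above ht] with j hj
    simp [R, rowCrossing_eq (h0 j) (h1 j), hj _ (h0 j) (h1 j)]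
  -- Within a row the column terms telescope to zero, leaving the difference of two row totals.
  -- These go from 1 at `-∞` to 0 at `+∞`.
  have hin : ∀ j : ℤ, HasSum (fun i => cellCount (scale (i, j) * t)) (R (j - 1) - R j) := by
    intro j
    have h := (hasSum_columnCrossing (scale_mul_pos ht (0, j))).sub ((hR j).sub (hR (j - 1)))
    rw [show R (j - 1) - R j = 0 - (R j - R (j - 1)) by ring]
    refine h.congr_fun fun i => ?_
    rw [cellCount_eq (scale_mul_pos ht _) (hg.scale _)]
    simp [scale_add_mul, sub_eq_neg_add]
  have hout : HasSum (fun j => R (j - 1) - R j) 1 := by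
    have h := (hasSum_int_telescope htop hbot).neg
    rw [show -(0 - 1 : ℝ) = 1 by norm_num] at h
    refine ((Equiv.subRight (1 : ℤ)).hasSum_iff.2 h).congr_fun fun j => ?_
    simp
  rw [ENNReal.tsum_prod (f := fun i j => ENNReal.ofReal (cellCount (scale (i, j) * t))),
    ENNReal.tsum_comm]
  have e : ∀ j : ℤ, ∑' i : ℤ, ENNReal.ofReal (cellCount (scale (i, j) * t)) =
      ENNReal.ofReal (R (j - 1) - R j) := fun j => by
    rw [← (hin j).tsum_eq, ENNReal.ofReal_tsum_of_nonneg (fun i => cellCount_nonneg _)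
      (hin j).summable]
  simp only [e]
  rw [← ENNReal.ofReal_tsum_of_nonneg (fun j => ?_) hout.summable, hout.tsum_eq,
    ENNReal.ofReal_one]
  exact (hin j).nonneg fun i => cellCount_nonneg _

end ConicalZeta

namespace ConicalZeta

open MeasureTheory

/-! ### Generic points -/

theorem ae_linear_ne {n : ℕ} {f : (Fin n → ℝ) → ℝ} (c : Fin n → ℝ)
    (hf : ∀ t, f t = ∑ i, c i * t i) {x : Fin n → ℝ} (hx : f x ≠ 0) :
    ∀ᵐ t : Fin n → ℝ, f t ≠ 0 := by
  set L : (Fin n → ℝ) →ₗ[ℝ] ℝ := ∑ i, c i • LinearMap.proj i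
  have hL : ∀ t, L t = f t := fun t => by simp [L, hf]
  have h := Measure.addHaar_submodule (volume : Measure (Fin n → ℝ)) (LinearMap.ker L) (by
    intro h
    apply hx
    rw [← hL, ← LinearMap.mem_ker, h]
    trivial)
  rw [ae_iff]
  convert h using 2
  ext t
  simp [hL]

/-- There are countably many walls, each a proper linear subspace. -/
theorem ae_generic : ∀ᵐ t : Fin 3 → ℝ, Generic t := by
  have h1 : ∀ p k, ∀ᵐ t : Fin 3 → ℝ, side (scale p * t) (vertex k) ≠ 0 := fun p k => by
    refine ae_linear_ne ![-vertex k 1 * scale p 0, vertex k 0 * scale p 1, 0] (fun t => ?_)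
      (x := ![0, 1, 0]) ?_
    · simp [side, Fin.sum_univ_three]; ring
    · simpa [side] using ⟨(vertex_pos k 0).ne', (scale_pos p 1).ne'⟩
  have h2 : ∀ (p : ℤ × ℤ) (a b c : Fin 3 → ℝ), triple a b c ≠ 0 →
      ∀ᵐ t : Fin 3 → ℝ, triple a b (scale p * t) ≠ 0 := fun p a b c h => by
    refine ae_linear_ne ![(a 1 * b 2 - a 2 * b 1) * scale p 0,
      (a 2 * b 0 - a 0 * b 2) * scale p 1, (a 0 * b 1 - a 1 * b 0) * scale p 2] (fun t => ?_)
      (x := scale (-p) * c) ?_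
    · simp [triple, Fin.sum_univ_three]; ring
    · simpa [scale_add_mul] using h
  have h3 : ∀ m, triple (vertex (coneIndex m 0)) (vertex (coneIndex m 1))
      (vertex (coneIndex m 2)) ≠ 0 := fun m => by rw [triple_cone]; norm_num
  have rot : ∀ a b c, triple a b c = triple b c a := fun a b c => by unfold triple; ring
  have h4 : ∀ p m, ∀ᵐ t : Fin 3 → ℝ,
      triple (vertex (coneIndex m 1)) (vertex (coneIndex m 2)) (scale p * t) ≠ 0 ∧
      triple (vertex (coneIndex m 2)) (vertex (coneIndex m 0)) (scale p * t) ≠ 0 ∧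
      triple (vertex (coneIndex m 0)) (vertex (coneIndex m 1)) (scale p * t) ≠ 0 := fun p m =>
    (h2 p _ _ (vertex (coneIndex m 0)) (by rw [← rot]; exact h3 m)).and
      ((h2 p _ _ (vertex (coneIndex m 1)) (by rw [rot]; exact h3 m)).and (h2 p _ _ _ (h3 m)))
  filter_upwards [ae_all_iff.2 fun p => ae_all_iff.2 (h1 p),
    ae_all_iff.2 fun p => ae_all_iff.2 (h4 p)] with t ht1 ht2
  exact ⟨ht1, ht2⟩

/-! ### Gamma integrals -/

/-- The open positive orthant. -/
def orthant (n : ℕ) : Set (Fin n → ℝ) := Set.univ.pi fun _ => Set.Ioi 0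

theorem mem_orthant {n : ℕ} {t : Fin n → ℝ} : t ∈ orthant n ↔ ∀ i, 0 < t i := by
  simp [orthant]

theorem measurableSet_orthant (n : ℕ) : MeasurableSet (orthant n) :=
  MeasurableSet.univ_pi fun _ => measurableSet_Ioi

theorem integral_pow_mul_exp (m : ℕ) {z : ℝ} (hz : 0 < z) :
    ∫ y in Set.Ioi (0 : ℝ), y ^ m * Real.exp (-(z * y)) = m.factorial / z ^ (m + 1) := by
  have h := Real.integral_rpow_mul_exp_neg_mul_Ioi (a := m + 1) (by positivity) hz
  rw [Real.Gamma_nat_eq_factorial] at h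
  simp only [add_sub_cancel_right, Real.rpow_natCast] at h
  rw [h, ← Nat.cast_add_one, Real.rpow_natCast, one_div, inv_pow, inv_mul_eq_div]

theorem integrable_pow_mul_exp (m : ℕ) {z : ℝ} (hz : 0 < z) :
    IntegrableOn (fun y : ℝ => y ^ m * Real.exp (-(z * y))) (Set.Ioi 0) := by
  -- A non-integrable function has Bochner integral `0`, so the nonzero value above already gives
  -- integrability.
  apply Integrable.of_integral_ne_zero
  rw [integral_pow_mul_exp m hz]
  positivity

theorem volume_restrict_orthant (n : ℕ) : (volume : Measure (Fin n → ℝ)).restrict (orthant n) =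
    Measure.pi fun _ => (volume : Measure ℝ).restrict (Set.Ioi 0) := by
  rw [volume_pi, orthant, Measure.restrict_pi_pi]

theorem prod_pow_mul_exp {n : ℕ} (m : Fin n → ℕ) (z y : Fin n → ℝ) :
    (∏ i, y i ^ m i) * Real.exp (-∑ i, z i * y i) =
      ∏ i, (y i ^ m i * Real.exp (-(z i * y i))) := by
  rw [Finset.prod_mul_distrib, ← Finset.sum_neg_distrib, Real.exp_sum]

theorem integrable_monomial_mul_exp {n : ℕ} (m : Fin n → ℕ) {z : Fin n → ℝ} (hz : ∀ i, 0 < z i) :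
    IntegrableOn (fun y : Fin n → ℝ => (∏ i, y i ^ m i) * Real.exp (-∑ i, z i * y i))
      (orthant n) := by
  simp only [prod_pow_mul_exp]
  rw [IntegrableOn, volume_restrict_orthant]
  exact Integrable.fintype_prod fun i => integrable_pow_mul_exp (m i) (hz i)

theorem integral_monomial_mul_exp {n : ℕ} (m : Fin n → ℕ) {z : Fin n → ℝ} (hz : ∀ i, 0 < z i) :
    ∫ y in orthant n, (∏ i, y i ^ m i) * Real.exp (-∑ i, z i * y i) =
      ∏ i, ((m i).factorial / z i ^ (m i + 1) : ℝ) := by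
  simp only [prod_pow_mul_exp]
  rw [volume_restrict_orthant,
    integral_fintype_prod_eq_prod (fun i y => y ^ m i * Real.exp (-(z i * y)))]
  exact Finset.prod_congr rfl fun i _ => integral_pow_mul_exp (m i) (hz i)

/-! ### The norm form as a sum over multi-indices -/

theorem isHomogeneous_normPoly (w : Fin 3 → Fin 3 → ℝ) : (normPoly w).IsHomogeneous 3 := by
  have h := MvPolynomial.IsHomogeneous.prod (Finset.univ : Finset (Fin 3))
    (fun i => ∑ j, MvPolynomial.C (w i j) * MvPolynomial.X j) (fun _ => 1)
    (fun i _ => MvPolynomial.IsHomogeneous.sum _ _ _ fun j _ =>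
      (MvPolynomial.isHomogeneous_X ℝ j).C_mul _)
  simpa [normPoly] using h

theorem isHomogeneous_substMatrix {A : Matrix (Fin 3) (Fin 3) ℤ} {p : MvPolynomial (Fin 3) ℝ}
    {d : ℕ} (hp : p.IsHomogeneous d) : (substMatrix A p).IsHomogeneous d := by
  have h := hp.aeval (fun j => ∑ l, MvPolynomial.C ((A j l : ℤ) : ℝ) * MvPolynomial.X l) (n := 1)
    (fun j => MvPolynomial.IsHomogeneous.sum _ _ _ fun l _ =>
      (MvPolynomial.isHomogeneous_X ℝ l).C_mul _)
  rw [one_mul] at h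
  exact h

/-- The power is homogeneous of degree `3(k - 1)`; raising each of the three exponents by one gives
weight `3k`. -/
theorem eval_substMatrix_pow (w : Fin 3 → Fin 3 → ℝ) (A : Matrix (Fin 3) (Fin 3) ℤ) {k : ℕ}
    (hk : 1 ≤ k) (y : Fin 3 → ℝ) :
    MvPolynomial.eval y (substMatrix A (normPoly w)) ^ (k - 1) =
      ∑ κ ∈ multiIndices 3 (3 * k), normCoeff w A k (fun j => κ j - 1) *
        ∏ j, y j ^ (κ j - 1) := by
  have hh := (isHomogeneous_substMatrix (A := A) (isHomogeneous_normPoly w)).pow (k - 1)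
  rw [← map_pow, MvPolynomial.eval_eq']
  refine Finset.sum_bij_ne_zero (fun d _ _ => fun j => d j + 1) ?_ ?_ ?_ ?_
  · intro d hd _
    have hdeg := hh.degree_eq_sum_deg_support hd
    rw [← Finsupp.degree_apply, Finsupp.degree_eq_sum] at hdeg
    rw [mem_multiIndices, Finset.sum_add_distrib, ← hdeg]
    refine ⟨?_, fun j => Nat.le_add_left _ _⟩
    simp
    omega
  · intro d _ _ d' _ _ h
    ext j
    simpa using congrFun h j
  · intro κ hκ hne
    have h1 := (mem_multiIndices.1 hκ).2
    refine ⟨Finsupp.equivFunOnFinite.symm fun j => κ j - 1, ?_, ?_, ?_⟩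
    · rw [MvPolynomial.mem_support_iff]
      exact left_ne_zero_of_mul hne
    · simpa [normCoeff] using hne
    · ext j
      have := h1 j
      simp; omega
  · intro d _ _
    simp [normCoeff]

/-- The contribution of one lattice point to the `i`-th inner sum. -/
def coneSum (i : Fin 4) (k : ℕ) (z : Fin 3 → ℝ) : ℝ :=
  ∑ κ ∈ multiIndices 3 (3 * k), ((∏ j, (κ j - 1).factorial : ℕ) : ℝ) *
    normCoeff wStar (coneMatrix i) k (fun j => κ j - 1) * (1 / ∏ j, z j ^ κ j)

/-- All coefficients of the four cubics are nonnegative, which allows the later passage to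
`ENNReal`. -/
theorem eval_coneMatrix_nonneg (i : Fin 4) {y : Fin 3 → ℝ} (hy : y ∈ orthant 3) :
    0 ≤ MvPolynomial.eval y (substMatrix (coneMatrix i) (normPoly wStar)) := by
  have hy := mem_orthant.1 hy
  have h0 := hy 0
  have h1 := hy 1
  have h2 := hy 2
  rw [eval_coneMatrix]
  fin_cases i <;> simp <;> positivity

theorem integrable_norm_mul_exp (i : Fin 4) {k : ℕ} (hk : 1 ≤ k) {z : Fin 3 → ℝ}
    (hz : ∀ i, 0 < z i) : IntegrableOn (fun y =>
      MvPolynomial.eval y (substMatrix (coneMatrix i) (normPoly wStar)) ^ (k - 1) *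
        Real.exp (-∑ i, z i * y i)) (orthant 3) := by
  simp only [eval_substMatrix_pow _ _ hk, Finset.sum_mul, mul_assoc]
  exact integrable_finsetSum _ fun κ _ => (integrable_monomial_mul_exp _ hz).const_mul _

theorem integral_norm_mul_exp (i : Fin 4) {k : ℕ} (hk : 1 ≤ k) {z : Fin 3 → ℝ}
    (hz : ∀ i, 0 < z i) : ∫ y in orthant 3,
      MvPolynomial.eval y (substMatrix (coneMatrix i) (normPoly wStar)) ^ (k - 1) *
        Real.exp (-∑ i, z i * y i) = coneSum i k z := by
  simp only [eval_substMatrix_pow _ _ hk, Finset.sum_mul, mul_assoc]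
  rw [integral_finsetSum _ fun κ _ => (integrable_monomial_mul_exp _ hz).const_mul _]
  refine Finset.sum_congr rfl fun κ hκ => ?_
  rw [integral_const_mul, integral_monomial_mul_exp _ hz, Finset.prod_div_distrib]
  have e : ∏ j, z j ^ (κ j - 1 + 1) = ∏ j, z j ^ κ j :=
    Finset.prod_congr rfl fun j _ => by
      rw [Nat.sub_add_cancel ((mem_multiIndices.1 hκ).2 j)]
  rw [e]
  push_cast
  ring

theorem norm_mul_exp_nonneg (i : Fin 4) (k : ℕ) (z : Fin 3 → ℝ) {y : Fin 3 → ℝ}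
    (hy : y ∈ orthant 3) :
    0 ≤ MvPolynomial.eval y (substMatrix (coneMatrix i) (normPoly wStar)) ^ (k - 1) *
      Real.exp (-∑ i, z i * y i) :=
  mul_nonneg (pow_nonneg (eval_coneMatrix_nonneg i hy) _) (Real.exp_nonneg _)

theorem coneSum_nonneg (i : Fin 4) {k : ℕ} (hk : 1 ≤ k) {z : Fin 3 → ℝ} (hz : ∀ i, 0 < z i) :
    0 ≤ coneSum i k z := by
  rw [← integral_norm_mul_exp i hk hz]
  exact setIntegral_nonneg (measurableSet_orthant 3) fun y hy => norm_mul_exp_nonneg i k z hy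

theorem lintegral_norm_mul_exp (i : Fin 4) {k : ℕ} (hk : 1 ≤ k) {z : Fin 3 → ℝ}
    (hz : ∀ i, 0 < z i) :
    ∫⁻ y in orthant 3, ENNReal.ofReal
      (MvPolynomial.eval y (substMatrix (coneMatrix i) (normPoly wStar)) ^ (k - 1) *
        Real.exp (-∑ i, z i * y i)) = ENNReal.ofReal (coneSum i k z) := by
  rw [← integral_norm_mul_exp i hk hz,
    ofReal_integral_eq_lintegral_ofReal (integrable_norm_mul_exp i hk hz)]
  exact (ae_restrict_iff' (measurableSet_orthant 3)).2
    (Filter.Eventually.of_forall fun y hy => norm_mul_exp_nonneg i k z hy)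

end ConicalZeta

namespace ConicalZeta

open MeasureTheory

/-! ### Unfolding -/

/-- The integrand `(t₁ t₂ t₃) ^ (k - 1) exp (-⟨c, t⟩)` on the positive octant. -/
def kernel (k : ℕ) (c : Fin 3 → ℝ) : (Fin 3 → ℝ) → ENNReal :=
  (orthant 3).indicator fun t =>
    ENNReal.ofReal ((∏ i, t i) ^ (k - 1) * Real.exp (-∑ i, c i * t i))

theorem measurable_kernel (k : ℕ) (c : Fin 3 → ℝ) : Measurable (kernel k c) := by
  refine Measurable.indicator ?_ (measurableSet_orthant 3)
  fun_prop

theorem lintegral_kernel {k : ℕ} (hk : 1 ≤ k) {c : Fin 3 → ℝ} (hc : ∀ i, 0 < c i) :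
    ∫⁻ t, kernel k c t = ENNReal.ofReal (((k - 1).factorial : ℝ) ^ 3 / (∏ i, c i) ^ k) := by
  have h := integral_monomial_mul_exp (fun _ => k - 1) hc
  have hi := integrable_monomial_mul_exp (fun _ => k - 1) hc
  simp only [Finset.prod_pow] at h hi
  rw [kernel, lintegral_indicator (measurableSet_orthant 3), ← ofReal_integral_eq_lintegral_ofReal hi,
    h]
  · congr 1
    rw [Nat.sub_add_cancel hk, Finset.prod_div_distrib, Finset.prod_pow]
    simp
  · refine (ae_restrict_iff' (measurableSet_orthant 3)).2 (Filter.Eventually.of_forall fun t ht => ?_)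
    have := Finset.prod_nonneg fun i (_ : i ∈ Finset.univ) => (mem_orthant.1 ht i).le
    simp only [Pi.zero_apply]
    positivity

/-- The units have norm one, so only the exponential sees the scaling, and there it can be moved
from `c` to `t`. -/
theorem kernel_scale (k : ℕ) (c : Fin 3 → ℝ) (p : ℤ × ℤ) (t : Fin 3 → ℝ) :
    kernel k (scale p * c) t = kernel k c (scale p * t) := by
  have h : scale p * t ∈ orthant 3 ↔ t ∈ orthant 3 := by
    simp only [mem_orthant, Pi.mul_apply, mul_pos_iff_of_pos_left (scale_pos p _)]
  by_cases ht : t ∈ orthant 3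
  · rw [kernel, kernel, Set.indicator_of_mem ht, Set.indicator_of_mem (h.2 ht)]
    simp only [Pi.mul_apply, Finset.prod_mul_distrib, prod_scale, one_mul]
    congr 4
    exact Finset.sum_congr rfl fun i _ => by ring
  · rw [kernel, kernel, Set.indicator_of_notMem ht, Set.indicator_of_notMem (mt h.1 ht)]

/-- The matrix with columns the vertices spanning a cell. -/
def cellMatrix (m : Fin 4) : Matrix (Fin 3) (Fin 3) ℝ :=
  Matrix.of fun i j => vertex (coneIndex m j) i

theorem det_cellMatrix (m : Fin 4) : (cellMatrix m).det = 1 / 7 := by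
  rw [← triple_cone m, Matrix.det_fin_three, triple]
  simp [cellMatrix]
  ring

theorem cellMatrix_mulVec_mem_cell (m : Fin 4) (y : Fin 3 → ℝ) :
    cellMatrix m *ᵥ y ∈ cell m ↔ y ∈ orthant 3 := by
  have h := triple_cone m
  have hD : triple (vertex (coneIndex m 1)) (vertex (coneIndex m 2)) (cellMatrix m *ᵥ y) =
      1 / 7 * y 0 := by
    rw [← h]; simp [triple, Matrix.mulVec, dotProduct, Fin.sum_univ_three, cellMatrix]; ring
  have hE : triple (vertex (coneIndex m 2)) (vertex (coneIndex m 0)) (cellMatrix m *ᵥ y) =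
      1 / 7 * y 1 := by
    rw [← h]; simp [triple, Matrix.mulVec, dotProduct, Fin.sum_univ_three, cellMatrix]; ring
  have hF : triple (vertex (coneIndex m 0)) (vertex (coneIndex m 1)) (cellMatrix m *ᵥ y) =
      1 / 7 * y 2 := by
    rw [← h]; simp [triple, Matrix.mulVec, dotProduct, Fin.sum_univ_three, cellMatrix]; ring
  simp only [cell, openCone, Set.mem_ofPred_eq, hD, hE, hF, mem_orthant, Fin.forall_fin_succ]
  simp

theorem cellMatrix_mulVec_pos (m : Fin 4) {y : Fin 3 → ℝ} (hy : ∀ j, 0 < y j) (i : Fin 3) :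
    0 < (cellMatrix m *ᵥ y) i :=
  Finset.sum_pos (fun j _ => mul_pos (show 0 < cellMatrix m i j from vertex_pos _ _) (hy j))
    Finset.univ_nonempty

theorem eval_substMatrix_cone (m : Fin 4) (y : Fin 3 → ℝ) :
    MvPolynomial.eval y (substMatrix (coneMatrix m) (normPoly wStar)) =
      ∏ i, (cellMatrix m *ᵥ y) i := by
  rw [eval_substMatrix, eval_normPoly]
  refine Finset.prod_congr rfl fun i _ => ?_
  simp only [Matrix.mulVec, dotProduct, cellMatrix, vertex, Matrix.map_apply, coneMatrix_apply,
    Matrix.of_apply, Finset.sum_mul]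
  rw [Finset.sum_comm]
  exact Finset.sum_congr rfl fun _ _ => Finset.sum_congr rfl fun _ _ => by ring

theorem measurable_triple (a b : Fin 3 → ℝ) : Measurable (triple a b) := by
  unfold triple
  fun_prop

theorem measurableSet_cell (m : Fin 4) : MeasurableSet (cell m) :=
  (measurableSet_lt measurable_const (measurable_triple _ _)).inter
    ((measurableSet_lt measurable_const (measurable_triple _ _)).inter
      (measurableSet_lt measurable_const (measurable_triple _ _)))

theorem transpose_cellMatrix_mulVec_pos (m : Fin 4) {c : Fin 3 → ℝ} (hc : ∀ i, 0 < c i)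
    (j : Fin 3) : 0 < ((cellMatrix m)ᵀ *ᵥ c) j :=
  Finset.sum_pos (fun i _ => mul_pos (show 0 < (cellMatrix m)ᵀ j i from vertex_pos _ _) (hc i))
    Finset.univ_nonempty

/-- Substitution `t = B y` carries the orthant onto the cell with Jacobian `1/7`; the product of
coordinates becomes the norm polynomial and `⟨c, B y⟩ = ⟨ᵗB c, y⟩`. -/
theorem ofReal_coneSum (m : Fin 4) {k : ℕ} (hk : 1 ≤ k) {c : Fin 3 → ℝ} (hc : ∀ i, 0 < c i) :
    ENNReal.ofReal (coneSum m k ((cellMatrix m)ᵀ *ᵥ c)) =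
      7 * ∫⁻ t, (cell m).indicator (kernel k c) t := by
  have hd : (cellMatrix m).det ≠ 0 := by rw [det_cellMatrix]; norm_num
  have hmap := Real.map_matrix_volume_pi_eq_smul_volume_pi hd
  have hmeas : Measurable ((cell m).indicator (kernel k c)) :=
    (measurable_kernel k c).indicator (measurableSet_cell m)
  have h := lintegral_map (μ := volume) hmeas
    (LinearMap.continuous_of_finiteDimensional (Matrix.toLin' (cellMatrix m))).measurable
  rw [hmap, lintegral_smul_measure, det_cellMatrix] at h
  have e7 : ENNReal.ofReal |((1 / 7 : ℝ))⁻¹| = 7 := by norm_num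
  rw [e7, smul_eq_mul] at h
  rw [h, ← lintegral_norm_mul_exp m hk, ← lintegral_indicator (measurableSet_orthant 3)]
  · refine lintegral_congr fun y => ?_
    rw [Matrix.toLin'_apply]
    by_cases hy : y ∈ orthant 3
    · rw [Set.indicator_of_mem hy, Set.indicator_of_mem ((cellMatrix_mulVec_mem_cell m y).2 hy),
        kernel, Set.indicator_of_mem (mem_orthant.2 (cellMatrix_mulVec_pos m (mem_orthant.1 hy))),
        eval_substMatrix_cone]
      congr 4
      change ((cellMatrix m)ᵀ *ᵥ c) ⬝ᵥ y = c ⬝ᵥ (cellMatrix m *ᵥ y)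
      rw [Matrix.dotProduct_mulVec, Matrix.mulVec_transpose]
    · rw [Set.indicator_of_notMem hy,
        Set.indicator_of_notMem (mt (cellMatrix_mulVec_mem_cell m y).1 hy)]
  · exact transpose_cellMatrix_mulVec_pos m hc

theorem sum_indicator_cell (f : (Fin 3 → ℝ) → ENNReal) (t : Fin 3 → ℝ) :
    ∑ m, (cell m).indicator f t = ENNReal.ofReal (cellCount t) * f t := by
  classical
  rw [cellCount, ENNReal.ofReal_sum_of_nonneg (fun m _ => by split_ifs <;> norm_num), Finset.sum_mul]
  refine Finset.sum_congr rfl fun m _ => ?_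
  by_cases h : t ∈ cell m <;> simp [h]

theorem measurable_cellCount : Measurable cellCount := by
  classical
  unfold cellCount
  exact Finset.measurable_sum _ fun m _ =>
    Measurable.ite (measurableSet_cell m) measurable_const measurable_const

theorem lintegral_scale (p : ℤ × ℤ) {f : (Fin 3 → ℝ) → ENNReal} (hf : Measurable f) :
    ∫⁻ t, f (scale p * t) = ∫⁻ t, f t := by
  have hd : (Matrix.diagonal (scale p)).det = 1 := by rw [Matrix.det_diagonal, prod_scale]
  have hmap := Real.map_matrix_volume_pi_eq_smul_volume_pi (M := Matrix.diagonal (scale p))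
    (by rw [hd]; norm_num)
  have h := lintegral_map (μ := volume) hf
    (LinearMap.continuous_of_finiteDimensional (Matrix.toLin' (Matrix.diagonal (scale p)))).measurable
  rw [hmap, hd] at h
  simp only [inv_one, abs_one, ENNReal.ofReal_one, one_smul] at h
  rw [h]
  refine lintegral_congr fun t => congrArg f ?_
  ext i
  simp [Matrix.mulVec_diagonal]

/-- Summation of the inner sums over an orbit of the unit group. -/
theorem tsum_coneSum {k : ℕ} (hk : 1 ≤ k) {c : Fin 3 → ℝ} (hc : ∀ i, 0 < c i) :
    ∑' p : ℤ × ℤ, ∑ m, ENNReal.ofReal (coneSum m k ((cellMatrix m)ᵀ *ᵥ (scale p * c))) =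
      7 * ENNReal.ofReal (((k - 1).factorial : ℝ) ^ 3 / (∏ i, c i) ^ k) := by
  have hm : ∀ p : ℤ × ℤ,
      Measurable fun t => ENNReal.ofReal (cellCount (scale p * t)) * kernel k c t := fun p =>
    (ENNReal.measurable_ofReal.comp (measurable_cellCount.comp (measurable_const_mul _))).mul
      (measurable_kernel k c)
  -- Moving the unit from `c` to `t` and changing variables fixes the kernel, so only the cell count
  -- depends on `p` and the tiling can be summed under the integral.
  have h1 : ∀ p : ℤ × ℤ,
      ∑ m, ENNReal.ofReal (coneSum m k ((cellMatrix m)ᵀ *ᵥ (scale p * c))) =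
      7 * ∫⁻ t, ENNReal.ofReal (cellCount (scale (-p) * t)) * kernel k c t := fun p => by
    simp only [ofReal_coneSum _ hk (scale_mul_pos hc p)]
    rw [← Finset.mul_sum, ← lintegral_finsetSum _ fun m _ =>
      (measurable_kernel k _).indicator (measurableSet_cell m), ← lintegral_scale p (hm (-p))]
    simp only [sum_indicator_cell, kernel_scale, scale_add_mul, neg_add_cancel, scale_zero, one_mul]
  simp only [h1]
  rw [ENNReal.tsum_mul_left, ← lintegral_tsum fun p => (hm (-p)).aemeasurable,
    ← lintegral_kernel hk hc]
  congr 1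
  refine lintegral_congr_ae ?_
  filter_upwards [ae_generic] with t hg
  by_cases ht : t ∈ orthant 3
  · have h := (Equiv.neg (ℤ × ℤ)).tsum_eq fun p => ENNReal.ofReal (cellCount (scale p * t))
    simp only [Equiv.neg_apply] at h
    rw [ENNReal.tsum_mul_right, h, tsum_cellCount (mem_orthant.1 ht) hg, one_mul]
  · simp [kernel, ht]

end ConicalZeta

namespace ConicalZeta

open NumberField Polynomial

/-! ### The embeddings of the cubic field -/

/-- The minimal polynomial of `η`. -/
def etaPoly (R : Type*) [Ring R] : R[X] := X ^ 3 + X ^ 2 - (X + X) - 1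

theorem etaPoly_monic (R : Type*) [Ring R] [Nontrivial R] : (etaPoly R).Monic := by
  unfold etaPoly
  monicity!

theorem etaPoly_natDegree (R : Type*) [Ring R] [Nontrivial R] : (etaPoly R).natDegree = 3 := by
  unfold etaPoly
  compute_degree!

theorem aeval_etaPoly {R A : Type*} [CommRing R] [CommRing A] [Algebra R A] (x : A) :
    aeval x (etaPoly R) = x ^ 3 + x ^ 2 - 2 * x - 1 := by
  simp [etaPoly, two_mul]

theorem etaPoly_irreducible : Irreducible (etaPoly ℚ) := by
  have hm := etaPoly_monic ℚ
  have hd := etaPoly_natDegree ℚ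
  rw [hm.irreducible_iff_roots_eq_zero_of_degree_le_three (by omega) (by omega)]
  refine Multiset.eq_zero_of_forall_notMem fun r hr => ?_
  have hroot : aeval r (etaPoly ℤ) = 0 := by
    have := (mem_roots hm.ne_zero).1 hr
    simpa [aeval_etaPoly, etaPoly, IsRoot, two_mul] using this
  obtain ⟨n, rfl⟩ := isInteger_of_is_root_of_monic (etaPoly_monic ℤ) hroot
  have h : n ^ 3 + n ^ 2 - 2 * n - 1 = 0 := by
    rw [aeval_etaPoly, algebraMap_int_eq, eq_intCast] at hroot
    exact_mod_cast hroot
  -- Since `n³ + n²` is always even, the left side is odd and cannot vanish.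
  rcases Int.even_or_odd n with ⟨m, rfl⟩ | ⟨m, rfl⟩
  · ring_nf at h; omega
  · ring_nf at h; omega

theorem eta_zero_eq : eta 0 = 2 * Real.cos (2 * Real.pi / 7) := by
  simp [eta]

theorem minpoly_eta : minpoly ℚ (2 * Real.cos (2 * Real.pi / 7)) = etaPoly ℚ := by
  symm
  refine minpoly.eq_of_irreducible_of_monic etaPoly_irreducible ?_ (etaPoly_monic ℚ)
  rw [← eta_zero_eq]
  simpa [aeval_etaPoly] using eta_cubic 0

theorem isIntegral_eta : IsIntegral ℚ (2 * Real.cos (2 * Real.pi / 7)) := by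
  refine ⟨etaPoly ℚ, etaPoly_monic ℚ, ?_⟩
  rw [← eta_zero_eq, ← aeval_def]
  simpa [aeval_etaPoly] using eta_cubic 0

theorem finrank_cubicField : Module.finrank ℚ CubicField = 3 := by
  rw [IntermediateField.adjoin.finrank isIntegral_eta, minpoly_eta, etaPoly_natDegree]

/-- The generator `η` of the cubic field. -/
def theta : CubicField := IntermediateField.AdjoinSimple.gen ℚ (2 * Real.cos (2 * Real.pi / 7))

/-- The embedding with `η ↦ η^(i)`. -/
def embedding (i : Fin 3) : CubicField →ₐ[ℚ] ℝ :=
  (IntermediateField.algHomAdjoinIntegralEquiv ℚ isIntegral_eta).symm ⟨eta i, by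
    rw [minpoly_eta, mem_aroots]
    refine ⟨(etaPoly_monic ℚ).ne_zero, ?_⟩
    simpa [aeval_etaPoly] using eta_cubic i⟩

theorem embedding_theta (i : Fin 3) : embedding i theta = eta i :=
  IntermediateField.algHomAdjoinIntegralEquiv_symm_apply_gen ℚ isIntegral_eta _

theorem eta_one_neg : eta 1 < 0 := by
  have h1 := eta_zero_gt
  have h2 := eta_zero_lt
  rw [eta_one]; nlinarith

theorem eta_two_lt : eta 2 < -1 := by
  have h1 := eta_zero_gt
  rw [eta_two]; nlinarith

theorem eta_one_gt : -1 < eta 1 := by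
  have h1 := eta_zero_gt
  rw [eta_one]; nlinarith

theorem eta_injective : Function.Injective eta := by
  have h0 := eta_zero_gt
  have h1 := eta_one_neg
  have h1' := eta_one_gt
  have h2 := eta_two_lt
  intro i j h
  fin_cases i <;> fin_cases j <;> simp at h ⊢ <;> linarith

/-- The complex embeddings of the cubic field. -/
def complexEmbedding (i : Fin 3) : CubicField →ₐ[ℚ] ℂ :=
  (Complex.ofRealAm.restrictScalars ℚ).comp (embedding i)

theorem complexEmbedding_apply (i : Fin 3) (z : CubicField) :
    complexEmbedding i z = (embedding i z : ℂ) := rfl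

theorem complexEmbedding_bijective : Function.Bijective complexEmbedding := by
  rw [Fintype.bijective_iff_injective_and_card, AlgHom.card, finrank_cubicField, Fintype.card_fin]
  refine ⟨fun i j h => ?_, rfl⟩
  have := DFunLike.congr_fun h theta
  rw [complexEmbedding_apply, complexEmbedding_apply, embedding_theta, embedding_theta] at this
  exact eta_injective (Complex.ofReal_injective this)

instance isTotallyReal_cubicField : IsTotallyReal CubicField where
  isReal v := by
    rw [InfinitePlace.isReal_iff, ComplexEmbedding.isReal_iff]
    obtain ⟨i, hi⟩ := complexEmbedding_bijective.2 v.embedding.toRatAlgHom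
    ext z
    have : v.embedding z = complexEmbedding i z := by rw [hi]; rfl
    rw [ComplexEmbedding.conjugate_coe_eq, this, complexEmbedding_apply, Complex.conj_ofReal]

/-! ### The ring of integers -/

/-- The conjugates of an integer of the cubic field. -/
def conj (i : Fin 3) : 𝓞 CubicField →+* ℝ :=
  (embedding i).toRingHom.comp (algebraMap (𝓞 CubicField) CubicField)

theorem conj_injective (i : Fin 3) : Function.Injective (conj i) :=
  (embedding i).toRingHom.injective.comp RingOfIntegers.coe_injective

theorem norm_eq_prod_conj (z : 𝓞 CubicField) : (Algebra.norm ℤ z : ℝ) = ∏ i, conj i z := by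
  have h := Algebra.norm_eq_prod_embeddings ℚ ℂ (z : CubicField)
  rw [← complexEmbedding_bijective.prod_comp, ← Algebra.coe_norm_int] at h
  apply Complex.ofReal_injective
  push_cast
  simpa [conj, complexEmbedding_apply] using h

theorem trace_eq_sum_conj (z : 𝓞 CubicField) : (Algebra.trace ℤ _ z : ℝ) = ∑ i, conj i z := by
  have h := trace_eq_sum_embeddings ℂ (K := ℚ) (x := (z : CubicField))
  rw [← complexEmbedding_bijective.sum_comp, ← Algebra.coe_trace_int] at h
  apply Complex.ofReal_injective
  push_cast
  simpa [conj, complexEmbedding_apply] using h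

/-- The algebraic integer `η`. -/
def thetaInt : 𝓞 CubicField := ⟨theta, by
  refine ⟨etaPoly ℤ, etaPoly_monic ℤ, (embedding 0).toRingHom.injective ?_⟩
  rw [← aeval_def]
  simpa [aeval_etaPoly, embedding_theta, map_ofNat] using eta_cubic 0⟩

@[simp] theorem conj_thetaInt (i : Fin 3) : conj i thetaInt = eta i := embedding_theta i

/-- The integer with coordinates `x` in the basis `(η², η, 1)`. -/
def toInteger : (Fin 3 → ℤ) →ₗ[ℤ] 𝓞 CubicField :=
  Fintype.linearCombination ℤ ![thetaInt ^ 2, thetaInt, 1]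

theorem conj_toInteger (i : Fin 3) (x : Fin 3 → ℤ) :
    conj i (toInteger x) = (fun j => (x j : ℝ)) ⬝ᵥ w i := by
  simp [toInteger, Fintype.linearCombination_apply, Fin.sum_univ_three, w, dotProduct]

theorem sum_dotProduct_mul_wStar (x : Fin 3 → ℝ) (a : Fin 3) :
    ∑ i, (x ⬝ᵥ w i) * wStar i a = x a := by
  simp only [dotProduct, Finset.sum_mul]
  rw [Finset.sum_comm]
  simp only [mul_assoc, ← Finset.mul_sum, sum_w_mul_wStar]
  simp

theorem toInteger_injective : Function.Injective toInteger := by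
  intro x y h
  ext a
  have hx := sum_dotProduct_mul_wStar (fun j => (x j : ℝ)) a
  have hy := sum_dotProduct_mul_wStar (fun j => (y j : ℝ)) a
  simp only [← conj_toInteger] at hx hy
  rw [h, hy] at hx
  exact_mod_cast hx.symm

/-- Eisenstein's argument at 7. The cubic form is the norm of `R + Qπ + Pπ²` with `π = 2 - η` of
norm 7, so divisibility by `7³` forces `7 ∣ R`, then `7 ∣ Q`, then `7 ∣ P`. -/
theorem seven_dvd_of_norm {P Q R : ℤ}
    (h : 343 ∣ R ^ 3 + 7 * R ^ 2 * Q + 21 * R ^ 2 * P + 14 * R * Q ^ 2 + 77 * R * Q * P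
      + 98 * R * P ^ 2 + 7 * Q ^ 3 + 49 * Q ^ 2 * P + 98 * Q * P ^ 2 + 49 * P ^ 3) :
    7 ∣ P ∧ 7 ∣ Q ∧ 7 ∣ R := by
  have p7 : Prime (7 : ℤ) := by norm_num
  have hR : 7 ∣ R := by
    apply p7.dvd_of_dvd_pow (n := 3)
    obtain ⟨c, hc⟩ := h
    exact ⟨49 * c - (R ^ 2 * Q + 3 * R ^ 2 * P + 2 * R * Q ^ 2 + 11 * R * Q * P
      + 14 * R * P ^ 2 + Q ^ 3 + 7 * Q ^ 2 * P + 14 * Q * P ^ 2 + 7 * P ^ 3), by linarith⟩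
  obtain ⟨R, rfl⟩ := hR
  have hQ : 7 ∣ Q := by
    apply p7.dvd_of_dvd_pow (n := 3)
    obtain ⟨c, hc⟩ := h
    exact ⟨7 * c - (7 * R ^ 3 + 7 * R ^ 2 * Q + 21 * R ^ 2 * P + 2 * R * Q ^ 2 + 11 * R * Q * P
      + 14 * R * P ^ 2 + Q ^ 2 * P + 2 * Q * P ^ 2 + P ^ 3), by linarith⟩
  obtain ⟨Q, rfl⟩ := hQ
  have hP : 7 ∣ P := by
    apply p7.dvd_of_dvd_pow (n := 3)
    obtain ⟨c, hc⟩ := h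
    exact ⟨c - (R ^ 3 + 7 * R ^ 2 * Q + 3 * R ^ 2 * P + 14 * R * Q ^ 2 + 11 * R * Q * P
      + 2 * R * P ^ 2 + 7 * Q ^ 3 + 7 * Q ^ 2 * P + 2 * Q * P ^ 2), by linarith⟩
  exact ⟨hP, dvd_mul_right _ _, dvd_mul_right _ _⟩

theorem prod_dotProduct_w (x : Fin 3 → ℝ) :
    ∏ i, x ⬝ᵥ w i = (fun P Q R => R ^ 3 + 7 * R ^ 2 * Q + 21 * R ^ 2 * P + 14 * R * Q ^ 2
      + 77 * R * Q * P + 98 * R * P ^ 2 + 7 * Q ^ 3 + 49 * Q ^ 2 * P + 98 * Q * P ^ 2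
      + 49 * P ^ 3) (x 0) (-(4 * x 0 + x 1)) (4 * x 0 + 2 * x 1 + x 2) := by
  have h := eta_zero_pow_three
  simp only [Fin.prod_univ_three, dotProduct, Fin.sum_univ_three, w, Matrix.cons_val,
    eta_one_sq, eta_two_sq]
  rw [eta_one, eta_two]
  generalize eta 0 = x at h ⊢
  grind

/-- The `β b` are the coordinates of `7w*`, so taking traces shows `7z ∈ ℤ[η]` for every integer
`z`. The norm of `7z` is divisible by `343`, and the Eisenstein argument removes the factor 7. -/
theorem toInteger_surjective : Function.Surjective toInteger := by
  intro z
  set β : Fin 3 → Fin 3 → ℤ := ![![2, 1, -3], ![1, 2, -1], ![-3, -1, 7]]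
  have hβ : ∀ i b, conj i (toInteger (β b)) = 7 * wStar i b := by
    intro i b
    rw [conj_toInteger]
    fin_cases b <;> simp [β, w, wStar, dotProduct, Fin.sum_univ_three] <;> ring
  set c : Fin 3 → ℤ := fun b => Algebra.trace ℤ _ (z * toInteger (β b))
  have hc : ∀ b, (c b : ℝ) = ∑ l, conj l z * (7 * wStar l b) := by
    intro b
    simp only [c, trace_eq_sum_conj, map_mul, hβ]
  have h7 : toInteger c = 7 * z := by
    apply conj_injective 0
    rw [conj_toInteger, dotProduct]
    simp only [hc, Finset.sum_mul]
    rw [Finset.sum_comm]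
    have e : ∀ l, ∑ b, conj l z * (7 * wStar l b) * w 0 b =
        7 * conj l z * ∑ b, wStar l b * w 0 b := fun l => by
      rw [Finset.mul_sum]
      exact Finset.sum_congr rfl fun b _ => by ring
    simp [e, sum_wStar_mul_w, map_ofNat]
  have hN := norm_eq_prod_conj (toInteger c)
  simp only [conj_toInteger, prod_dotProduct_w] at hN
  rw [h7, map_mul] at hN
  have h343 : Algebra.norm ℤ (7 : 𝓞 CubicField) = 343 := by
    have := norm_eq_prod_conj 7
    simp only [map_ofNat, Fin.prod_univ_three] at this
    norm_num at this
    exact_mod_cast this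
  rw [h343] at hN
  obtain ⟨h0, h1, h2⟩ := seven_dvd_of_norm ⟨Algebra.norm ℤ z, by exact_mod_cast hN.symm⟩
  have hd : ∀ b, 7 ∣ c b := by
    intro b
    fin_cases b
    · exact h0
    · simp only [Fin.mk_one]; omega
    · simp only [Fin.reduceFinMk]; omega
  choose d hd using hd
  refine ⟨d, ?_⟩
  have h7' : (7 : 𝓞 CubicField) ≠ 0 := by norm_num
  apply mul_left_cancel₀ h7'
  rw [← h7, show c = (7 : ℤ) • d from funext hd, map_smul]
  simp

/-- `(η², η, 1)` is an integral basis. -/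
def toIntegerEquiv : (Fin 3 → ℤ) ≃ₗ[ℤ] 𝓞 CubicField :=
  LinearEquiv.ofBijective toInteger ⟨toInteger_injective, toInteger_surjective⟩

theorem discr_cubicField : NumberField.discr CubicField = 49 := by
  set b := Module.Basis.ofEquivFun toIntegerEquiv.symm
  have hb : ∀ i l, conj l (b i) = w l i := by
    intro i l
    have : b i = toInteger (Pi.single i 1) := by
      simp [b, toIntegerEquiv]
      rfl
    rw [this, conj_toInteger]
    fin_cases i <;> simp [dotProduct, Pi.single_apply]
  have hM : Algebra.traceMatrix ℤ b = !![13, -4, 5; -4, 5, -1; 5, -1, 3] := by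
    ext i j
    have h := trace_eq_sum_conj (b i * b j)
    simp only [map_mul, hb, Fin.sum_univ_three] at h
    rw [Algebra.traceMatrix_apply, Algebra.traceForm_apply]
    rw [← Int.cast_inj (α := ℝ), h]
    clear h
    have h := eta_zero_pow_three
    fin_cases i <;> fin_cases j <;> simp [w, eta_one_sq, eta_two_sq] <;>
      (try simp only [eta_one, eta_two]) <;> generalize eta 0 = x at h ⊢ <;> grind
  rw [← discr_eq_discr CubicField b, Algebra.discr_def, hM]
  simp [Matrix.det_fin_three]

/-- The Minkowski bound is `(3!/3³)·√49 = 14/9 < 2`. -/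
instance isPrincipalIdealRing_cubicField : IsPrincipalIdealRing (𝓞 CubicField) := by
  apply RingOfIntegers.isPrincipalIdealRing_of_abs_discr_lt
  rw [discr_cubicField, IsTotallyReal.nrComplexPlaces_eq_zero, finrank_cubicField]
  norm_num [Nat.factorial]

/-! ### Units -/

/-- The unit `η² - η`. -/
def unitA : (𝓞 CubicField)ˣ where
  val := thetaInt ^ 2 - thetaInt
  inv := thetaInt + 2
  val_inv := conj_injective 0 (by simp [map_ofNat]; linear_combination eta_cubic 0)
  inv_val := conj_injective 0 (by simp [map_ofNat]; linear_combination eta_cubic 0)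

theorem eta_zero_sq_mul : eta 0 ^ 2 * (-2 * eta 0 ^ 2 - eta 0 + 5) = 1 := by
  have h := eta_zero_pow_three
  generalize eta 0 = x at h ⊢
  grind

/-- The unit `-2η² - η + 5 = η⁻²`. -/
def unitB : (𝓞 CubicField)ˣ where
  val := -2 * thetaInt ^ 2 - thetaInt + 5
  inv := thetaInt ^ 2
  val_inv := conj_injective 0 (by simpa [mul_comm, map_ofNat] using eta_zero_sq_mul)
  inv_val := conj_injective 0 (by simpa [map_ofNat] using eta_zero_sq_mul)

/-- The unit `η`. -/
def unitEta : (𝓞 CubicField)ˣ where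
  val := thetaInt
  inv := thetaInt ^ 2 + thetaInt - 2
  val_inv := conj_injective 0 (by simp [map_ofNat]; linear_combination eta_cubic 0)
  inv_val := conj_injective 0 (by simp [map_ofNat]; linear_combination eta_cubic 0)

/-- The unit `1 + η`. -/
def unitOnePlus : (𝓞 CubicField)ˣ where
  val := 1 + thetaInt
  inv := 2 - thetaInt ^ 2
  val_inv := conj_injective 0 (by simp [map_ofNat]; linear_combination -eta_cubic 0)
  inv_val := conj_injective 0 (by simp [map_ofNat]; linear_combination -eta_cubic 0)

theorem conj_unitA (i : Fin 3) : conj i unitA = unitOne i := by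
  fin_cases i <;> simp [unitA, unitOne, eta_one_sq, eta_two_sq] <;>
    (try simp only [eta_one, eta_two]) <;> ring

theorem conj_unitB (i : Fin 3) : conj i unitB = unitTwo i := by
  fin_cases i <;> simp [unitB, unitTwo, map_ofNat, eta_one_sq, eta_two_sq] <;>
    (try simp only [eta_one, eta_two]) <;> ring

/-- Products of powers of the two totally positive units. -/
def unitPow (p : ℤ × ℤ) : (𝓞 CubicField)ˣ := unitA ^ p.1 * unitB ^ p.2

theorem conj_zpow (i : Fin 3) (u : (𝓞 CubicField)ˣ) (n : ℤ) :
    conj i ((u ^ n : (𝓞 CubicField)ˣ) : 𝓞 CubicField) = conj i u ^ n := by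
  have h := congrArg Units.val (map_zpow (Units.map (conj i).toMonoidHom) u n)
  rw [Units.val_zpow_eq_zpow_val] at h
  exact h

theorem conj_unitPow (p : ℤ × ℤ) (i : Fin 3) : conj i (unitPow p) = scale p i := by
  rw [unitPow, Units.val_mul, map_mul, conj_zpow, conj_zpow, conj_unitA, conj_unitB, scale]

/-- Every nonzero integer has an associate which is totally positive. -/
theorem exists_unit_mul_totallyPositive {z : 𝓞 CubicField} (hz : z ≠ 0) :
    ∃ u : (𝓞 CubicField)ˣ, ∀ i, 0 < conj i (z * u) := by
  have hne : ∀ i, conj i z ≠ 0 := fun i => (map_ne_zero_iff _ (conj_injective i)).2 hz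
  have h0 := eta_zero_gt
  have h1 := eta_one_neg
  have h1' := eta_one_gt
  have h2 := eta_two_lt
  have hE : ∀ i, conj i unitEta = eta i := fun i => conj_thetaInt i
  have hO : ∀ i, conj i unitOnePlus = 1 + eta i := fun i => by simp [unitOnePlus]
  have e0 : 0 < conj 0 unitEta := by rw [hE]; linarith
  have e1 : conj 1 unitEta < 0 := by rw [hE]; exact h1
  have e2 : conj 2 unitEta < 0 := by rw [hE]; linarith
  have p0 : 0 < conj 0 unitOnePlus := by rw [hO]; linarith
  have p1 : 0 < conj 1 unitOnePlus := by rw [hO]; linarith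
  have p2 : conj 2 unitOnePlus < 0 := by rw [hO]; linarith
  have hQ : ∀ i, conj i (unitEta * unitOnePlus : (𝓞 CubicField)ˣ) =
      conj i unitEta * conj i unitOnePlus := fun i => by rw [Units.val_mul, map_mul]
  have q0 : 0 < conj 0 (unitEta * unitOnePlus : (𝓞 CubicField)ˣ) := by
    rw [hQ]; exact mul_pos e0 p0
  have q1 : conj 1 (unitEta * unitOnePlus : (𝓞 CubicField)ˣ) < 0 := by
    rw [hQ]; exact mul_neg_of_neg_of_pos e1 p1
  have q2 : 0 < conj 2 (unitEta * unitOnePlus : (𝓞 CubicField)ˣ) := by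
    rw [hQ]; exact mul_pos_of_neg_of_neg e2 p2
  have key : ∀ u : (𝓞 CubicField)ˣ, (0 < conj 0 z * conj 0 u ∧ 0 < conj 1 z * conj 1 u ∧
      0 < conj 2 z * conj 2 u) → ∃ u : (𝓞 CubicField)ˣ, ∀ i, 0 < conj i (z * u) := by
    rintro u ⟨p0, p1, p2⟩
    refine ⟨u, fun i => ?_⟩
    rw [map_mul]
    fin_cases i
    · exact p0
    · exact p1
    · exact p2
  -- The signatures of `η` and `1 + η` are `(+,-,-)` and `(+,+,-)`; together with `-1` they generate
  -- all eight sign patterns.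
  rcases lt_or_gt_of_ne (hne 0) with a0 | a0 <;> rcases lt_or_gt_of_ne (hne 1) with a1 | a1 <;>
    rcases lt_or_gt_of_ne (hne 2) with a2 | a2
  · exact key (-1) (by simp [a0, a1, a2])
  · refine key (-unitOnePlus) ?_
    simp only [Units.val_neg, map_neg]
    exact ⟨mul_pos_of_neg_of_neg a0 (neg_neg_of_pos p0), mul_pos_of_neg_of_neg a1 (neg_neg_of_pos p1),
      mul_pos a2 (neg_pos.2 p2)⟩
  · refine key (-(unitEta * unitOnePlus)) ?_
    simp only [Units.val_neg, map_neg]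
    exact ⟨mul_pos_of_neg_of_neg a0 (neg_neg_of_pos q0), mul_pos a1 (neg_pos.2 q1),
      mul_pos_of_neg_of_neg a2 (neg_neg_of_pos q2)⟩
  · refine key (-unitEta) ?_
    simp only [Units.val_neg, map_neg]
    exact ⟨mul_pos_of_neg_of_neg a0 (neg_neg_of_pos e0), mul_pos a1 (neg_pos.2 e1),
      mul_pos a2 (neg_pos.2 e2)⟩
  · exact key unitEta ⟨mul_pos a0 e0, mul_pos_of_neg_of_neg a1 e1,
      mul_pos_of_neg_of_neg a2 e2⟩
  · exact key (unitEta * unitOnePlus) ⟨mul_pos a0 q0, mul_pos_of_neg_of_neg a1 q1,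
      mul_pos a2 q2⟩
  · exact key unitOnePlus ⟨mul_pos a0 p0, mul_pos a1 p1,
      mul_pos_of_neg_of_neg a2 p2⟩
  · exact key 1 (by simp [a0, a1, a2])

end ConicalZeta

namespace ConicalZeta

open NumberField

/-! ### The group of totally positive units -/

/-- In each cubic the coefficients are nonnegative and those of the pure cubes are at least 1. Hence
bounded norm on a closed cell means bounded coordinates. -/
theorem pow_three_le_prod_cell (m : Fin 4) {y : Fin 3 → ℝ} (hy : ∀ j, 0 ≤ y j) (j : Fin 3) :
    y j ^ 3 ≤ 49 * ∏ i, (cellMatrix m *ᵥ y) i := by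
  rw [← eval_substMatrix_cone, eval_coneMatrix, mul_div_cancel₀ _ (by norm_num)]
  have h0 := hy 0
  have h1 := hy 1
  have h2 := hy 2
  have m1 : 0 ≤ y 0 ^ 3 := by positivity
  have m2 : 0 ≤ y 0 ^ 2 * y 1 := by positivity
  have m3 : 0 ≤ y 0 ^ 2 * y 2 := by positivity
  have m4 : 0 ≤ y 0 * y 1 ^ 2 := by positivity
  have m5 : 0 ≤ y 0 * y 1 * y 2 := by positivity
  have m6 : 0 ≤ y 0 * y 2 ^ 2 := by positivity
  have m7 : 0 ≤ y 1 ^ 3 := by positivity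
  have m8 : 0 ≤ y 1 ^ 2 * y 2 := by positivity
  have m9 : 0 ≤ y 1 * y 2 ^ 2 := by positivity
  have m10 : 0 ≤ y 2 ^ 3 := by positivity
  fin_cases m <;> fin_cases j <;> simp <;> linarith

theorem vertex_lt (k : Fin 5) (i : Fin 3) : vertex k i < 3 := by
  have h1 := eta_zero_gt
  have h2 := eta_zero_lt
  fin_cases k <;> simp only [Fin.zero_eta, Fin.mk_one, Fin.reduceFinMk, vertex_zero, vertex_one,
    vertex_two, vertex_three, vertex_four] <;> fin_cases i <;> simp <;> nlinarith

/-- Products of an integer with `α₀` pair integrally. -/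
theorem exists_int_sum_conj_mul_vertex (b : 𝓞 CubicField) :
    ∃ n : ℤ, ∑ i, conj i b * vertex 0 i = n := by
  obtain ⟨x, rfl⟩ := toInteger_surjective b
  refine ⟨∑ l, alpha 0 l * x l, ?_⟩
  simp only [vertex, Finset.mul_sum]
  rw [Finset.sum_comm]
  push_cast
  refine Finset.sum_congr rfl fun l _ => ?_
  rw [← sum_dotProduct_mul_wStar (fun j => (x j : ℝ)) l, Finset.mul_sum]
  refine Finset.sum_congr rfl fun i _ => ?_
  rw [conj_toInteger]
  ring

theorem conj_toInteger_single (i j : Fin 3) : conj i (toInteger (Pi.single j 1)) = w i j := by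
  rw [conj_toInteger]
  fin_cases j <;> simp [dotProduct, Pi.single_apply]

/-- The points `b α₀` have integral coordinates with respect to the generators of each cell. -/
theorem exists_int_coordinates (m : Fin 4) (b : 𝓞 CubicField) :
    ∃ N : Fin 3 → ℤ, ∀ i, conj i b * vertex 0 i = (cellMatrix m *ᵥ fun j => (N j : ℝ)) i := by
  choose a ha using fun j => exists_int_sum_conj_mul_vertex (b * toInteger (Pi.single j 1))
  simp only [map_mul, conj_toInteger_single] at ha
  have hI : coneMatrix m * (coneMatrix m)⁻¹ = 1 :=
    Matrix.mul_nonsing_inv _ (by rw [det_coneMatrix]; exact isUnit_one)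
  refine ⟨(coneMatrix m)⁻¹ *ᵥ a, fun i => ?_⟩
  have hN : coneMatrix m *ᵥ ((coneMatrix m)⁻¹ *ᵥ a) = a := by
    rw [Matrix.mulVec_mulVec, hI, Matrix.one_mulVec]
  set N := (coneMatrix m)⁻¹ *ᵥ a
  have h1 : (cellMatrix m *ᵥ fun j => (N j : ℝ)) i = ∑ l, (a l : ℝ) * wStar i l := by
    rw [← hN]
    simp only [Matrix.mulVec, dotProduct, cellMatrix, vertex, coneMatrix_apply,
      Matrix.of_apply, Finset.sum_mul]
    rw [Finset.sum_comm]
    push_cast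
    simp only [Finset.sum_mul]
    exact Finset.sum_congr rfl fun _ _ => Finset.sum_congr rfl fun _ _ => by ring
  rw [h1]
  simp only [← ha, Finset.sum_mul]
  rw [Finset.sum_comm]
  have e : ∀ l, ∑ j, conj l b * w l j * vertex 0 l * wStar i j =
      conj l b * vertex 0 l * ∑ j, wStar i j * w l j := fun l => by
    rw [Finset.mul_sum]
    exact Finset.sum_congr rfl fun _ _ => by ring
  simp [e, sum_wStar_mul_w]

theorem prod_vertex_zero : ∏ i, vertex 0 i = 1 / 49 := by
  have h := prod_dotProduct_wStar fun j => (alpha 0 j : ℝ)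
  have e : ∏ i, vertex 0 i = ∏ i, (fun j => (alpha 0 j : ℝ)) ⬝ᵥ wStar i := rfl
  rw [e, h]
  simp [alpha]
  norm_num

/-- The cubic takes the value 1 at `N`, so the entries of `N` are 0 or 1 and only a single corner
survives. It is not `α₄`, where the cubic takes the value 7. -/
theorem eq_vertex_of_prod_eq (m : Fin 4) {N : Fin 3 → ℤ} (hN : ∀ j, 0 ≤ N j)
    (h : ∏ i, (cellMatrix m *ᵥ fun j => (N j : ℝ)) i = 1 / 49) :
    ∃ p, (cellMatrix m *ᵥ fun j => (N j : ℝ)) = scale p * vertex 0 := by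
  have hle : ∀ j, N j ≤ 1 := fun j => by
    have h1 := pow_three_le_prod_cell m (y := fun j => (N j : ℝ)) (fun j => by exact_mod_cast hN j) j
    rw [h] at h1
    have h2 : N j ^ 3 ≤ 1 := by
      have : (N j : ℝ) ^ 3 ≤ 1 := by linarith
      exact_mod_cast this
    by_contra hc
    have := pow_le_pow_left₀ (by norm_num) (show 2 ≤ N j by omega) 3
    omega
  rw [← eval_substMatrix_cone, eval_coneMatrix] at h
  have hv : ∀ i : Fin 3 , (cellMatrix m *ᵥ fun j => (N j : ℝ)) i =
      vertex (coneIndex m 0) i * N 0 + vertex (coneIndex m 1) i * N 1 +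
        vertex (coneIndex m 2) i * N 2 := fun i => by
    simp [Matrix.mulVec, dotProduct, Fin.sum_univ_three, cellMatrix]
  have key : ∀ k p, vertex k = scale p * vertex 0 →
      (∀ i, (cellMatrix m *ᵥ fun j => (N j : ℝ)) i = vertex k i) →
      ∃ p, (cellMatrix m *ᵥ fun j => (N j : ℝ)) = scale p * vertex 0 := fun k p h1 h2 =>
    ⟨p, by rw [← h1]; exact funext h2⟩
  by_contra hG
  have k0 := mt (key 0 0 (by simp)) hG
  have k1 := mt (key 1 _ vertex_one_eq) hG
  have k2 := mt (key 2 _ vertex_two_eq) hG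
  have k3 := mt (key 3 _ vertex_three_eq) hG
  simp only [hv] at k0 k1 k2 k3
  have a0 := hN 0
  have a1 := hN 1
  have a2 := hN 2
  have b0 := hle 0
  have b1 := hle 1
  have b2 := hle 2
  clear key hv hle hG hN
  generalize N 0 = x at *
  generalize N 1 = y at *
  generalize N 2 = z at *
  fin_cases m <;> interval_cases x <;> interval_cases y <;> interval_cases z <;>
    first
    | (norm_num at h; done)
    | (refine k0 fun i => ?_; simp [coneIndex]; done)
    | (refine k1 fun i => ?_; simp [coneIndex]; done)
    | (refine k2 fun i => ?_; simp [coneIndex]; done)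
    | (refine k3 fun i => ?_; simp [coneIndex])

/-- By the tiling, some translate of `u a₀` lies in a closed cell. There it has nonnegative integral
coordinates and norm `1/49`, so it is a corner, hence a translate of `a₀`. -/
theorem exists_unitPow_of_totallyPositive {u : (𝓞 CubicField)ˣ} (hu : ∀ i, 0 < conj i u) :
    ∃ p, u = unitPow p := by
  set K : ℝ := ∑ m, ∑ j, ∑ i, |(cellMatrix m)⁻¹ j i|
  have hK : 0 ≤ K := by positivity
  -- Chosen so that `36 c K < 1`: a perturbation of relative size `c` moves the cell coordinates by
  -- less than one.
  set c : ℝ := 1 / (36 * (K + 1))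
  have hc : 0 < c := by positivity
  have hc1 : c ≤ 1 := by
    rw [div_le_one (by positivity)]; linarith
  set v : Fin 3 → ℝ := fun i => conj i u * vertex 0 i
  have hv : ∀ i, 0 < v i := fun i => mul_pos (hu i) (vertex_pos 0 i)
  -- The tiling is known only at generic points, and `v` lies on walls, so it is replaced by a
  -- nearby generic point.
  obtain ⟨t, hg, ht⟩ : ∃ t, Generic t ∧ ∀ i, v i < t i ∧ t i < (1 + c) * v i := by
    have hd := MeasureTheory.Measure.dense_of_ae ae_generic
    have ho : IsOpen (Set.univ.pi fun i => Set.Ioo (v i) ((1 + c) * v i)) :=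
      isOpen_set_pi Set.finite_univ fun i _ => isOpen_Ioo
    obtain ⟨t, ht, hg⟩ := hd.inter_open_nonempty _ ho (Set.univ_pi_nonempty_iff.2 fun i =>
      Set.nonempty_Ioo.2 (by nlinarith [hv i, mul_pos hc (hv i)]))
    exact ⟨t, hg, fun i => ht i (Set.mem_univ i)⟩
  have htp : ∀ i, 0 < t i := fun i => (hv i).trans (ht i).1
  obtain ⟨p, m, hm⟩ : ∃ p m, scale p * t ∈ cell m := by
    by_contra hcon
    push Not at hcon
    have := tsum_cellCount htp hg
    simp [cellCount, hcon] at this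
  set s := scale p * t
  set z := scale p * v
  have hz : ∀ i, 0 < z i := scale_mul_pos hv p
  have hs : ∀ i, z i < s i ∧ s i < (1 + c) * z i := fun i =>
    ⟨mul_lt_mul_of_pos_left (ht i).1 (scale_pos p i), by
      have := mul_lt_mul_of_pos_left (ht i).2 (scale_pos p i)
      simp only [s, z, Pi.mul_apply]; linarith⟩
  have hB : IsUnit (cellMatrix m).det := by rw [det_cellMatrix]; norm_num
  set y := (cellMatrix m)⁻¹ *ᵥ s
  have hy : cellMatrix m *ᵥ y = s := by
    rw [Matrix.mulVec_mulVec, Matrix.mul_nonsing_inv _ hB, Matrix.one_mulVec]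
  have hypos : ∀ j, 0 < y j := by
    rw [← hy, cellMatrix_mulVec_mem_cell] at hm
    exact mem_orthant.1 hm
  obtain ⟨N, hN⟩ := exists_int_coordinates m (unitPow p * u : (𝓞 CubicField)ˣ)
  have hzN : cellMatrix m *ᵥ (fun j => (N j : ℝ)) = z := by
    ext i
    rw [← hN i, Units.val_mul, map_mul, conj_unitPow]
    simp only [z, v, Pi.mul_apply]; ring
  have hprodu : ∏ i, conj i u = 1 := by
    have h1 := norm_eq_prod_conj u
    have h2 : IsUnit (Algebra.norm ℤ (u : 𝓞 CubicField)) := u.isUnit.map _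
    have h3 : 0 < ∏ i, conj i u := Finset.prod_pos fun i _ => hu i
    rcases Int.isUnit_iff.1 h2 with h | h <;> rw [h] at h1
    · rw [← h1]; simp
    · rw [← h1] at h3; norm_num at h3
  have hprodz : ∏ i, z i = 1 / 49 := by
    simp only [z, v, Pi.mul_apply, Finset.prod_mul_distrib, prod_scale, hprodu, prod_vertex_zero]
    norm_num
  have hprods : ∏ i, s i ≤ 8 / 49 := by
    calc ∏ i, s i ≤ ∏ i, 2 * z i := Finset.prod_le_prod
          (fun i _ => ((hz i).trans (hs i).1).le) fun i _ => by nlinarith [(hs i).2, hz i]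
      _ = 8 / 49 := by rw [Finset.prod_mul_distrib, hprodz]; norm_num
  have hyle : ∀ j, y j ≤ 4 := fun j => by
    have h1 := pow_three_le_prod_cell m (fun j => (hypos j).le) j
    rw [hy] at h1
    by_contra hcon
    have := pow_le_pow_left₀ (by norm_num) (not_le.1 hcon).le 3
    linarith
  have hsle : ∀ i, s i ≤ 36 := fun i => by
    rw [← hy]
    calc ∑ j, cellMatrix m i j * y j ≤ ∑ j : Fin 3, 3 * 4 := Finset.sum_le_sum fun j _ =>
          mul_le_mul (vertex_lt _ _).le (hyle j) (hypos j).le (by norm_num)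
      _ = 36 := by norm_num
  have hdiff : ∀ j, y j - N j < 1 := fun j => by
    have e : y j - N j = ∑ i, (cellMatrix m)⁻¹ j i * (s i - z i) := by
      have h1 : (fun j => (N j : ℝ)) = (cellMatrix m)⁻¹ *ᵥ z := by
        rw [← hzN, Matrix.mulVec_mulVec, Matrix.nonsing_inv_mul _ hB, Matrix.one_mulVec]
      have h2 : (N j : ℝ) = ((cellMatrix m)⁻¹ *ᵥ z) j := congrFun h1 j
      rw [h2, ← Pi.sub_apply, ← Matrix.mulVec_sub]
      rfl
    have h1 : ∑ i, |(cellMatrix m)⁻¹ j i| ≤ K := by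
      calc ∑ i, |(cellMatrix m)⁻¹ j i| ≤ ∑ j, ∑ i, |(cellMatrix m)⁻¹ j i| :=
            Finset.single_le_sum (f := fun j => ∑ i, |(cellMatrix m)⁻¹ j i|)
              (fun _ _ => by positivity) (Finset.mem_univ j)
        _ ≤ K := Finset.single_le_sum (f := fun m => ∑ j, ∑ i, |(cellMatrix m)⁻¹ j i|)
              (fun _ _ => by positivity) (Finset.mem_univ m)
    calc y j - N j = ∑ i, (cellMatrix m)⁻¹ j i * (s i - z i) := e
      _ ≤ ∑ i, |(cellMatrix m)⁻¹ j i| * (36 * c) := Finset.sum_le_sum fun i _ => by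
          have h3 : 0 ≤ s i - z i := by linarith [(hs i).1]
          have h4 : s i - z i ≤ 36 * c := by nlinarith [(hs i).2, (hs i).1, hsle i, hz i]
          exact (mul_le_mul_of_nonneg_right (le_abs_self _) h3).trans
            (mul_le_mul_of_nonneg_left h4 (abs_nonneg _))
      _ = (∑ i, |(cellMatrix m)⁻¹ j i|) * (36 * c) := by rw [Finset.sum_mul]
      _ ≤ K * (36 * c) := mul_le_mul_of_nonneg_right h1 (by positivity)
      _ < 1 := by
          simp only [c]
          rw [← mul_assoc, mul_one_div, div_lt_one (by positivity)]
          linarith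
  -- The perturbed coordinate is positive and exceeds the integer `N j` by less than one, so `N j >
  -- -1`.
  have hN0 : ∀ j, 0 ≤ N j := fun j => by
    have h1 : (-1 : ℝ) < N j := by linarith [hdiff j, hypos j]
    have h2 : (-1 : ℤ) < N j := by exact_mod_cast h1
    omega
  obtain ⟨q, hq⟩ := eq_vertex_of_prod_eq m hN0 (by rw [hzN, hprodz])
  have hU : unitPow p * u = unitPow q := by
    apply Units.ext
    apply conj_injective 0
    have := congrFun hq 0
    rw [← hN 0] at this
    rw [conj_unitPow]
    exact mul_right_cancel₀ (vertex_pos 0 0).ne' this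
  have hinv : ∀ p q, unitPow (p + q) = unitPow p * unitPow q := fun p q => by
    simp only [unitPow, Prod.fst_add, Prod.snd_add, zpow_add]
    exact mul_mul_mul_comm _ _ _ _
  refine ⟨-p + q, ?_⟩
  rw [hinv, ← hU, ← mul_assoc, ← hinv]
  simp [unitPow]

end ConicalZeta

namespace ConicalZeta

open NumberField

/-! ### Lattice points of the dual cones -/

/-- By duality of `w` and `w*`, the cone `C_m` becomes the image under `ᵗB` of vectors of positive
conjugates. -/
theorem transpose_coneMatrix_mulVec (m : Fin 4) (x : Fin 3 → ℝ) :
    ((coneMatrix m).map (Int.cast : ℤ → ℝ))ᵀ *ᵥ x = (cellMatrix m)ᵀ *ᵥ fun i => x ⬝ᵥ w i := by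
  ext j
  simp only [Matrix.mulVec, dotProduct, Matrix.transpose_apply, Matrix.map_apply, cellMatrix,
    Matrix.of_apply, coneMatrix_apply, vertex, Finset.sum_mul]
  rw [Finset.sum_comm]
  refine Finset.sum_congr rfl fun l _ => ?_
  rw [← sum_dotProduct_mul_wStar x l, Finset.mul_sum]
  refine Finset.sum_congr rfl fun i _ => ?_
  rw [dotProduct]
  ring

theorem mem_dualCone_iff (m : Fin 4) (x : Fin 3 → ℝ) :
    x ∈ dualCone m ↔ ∃ y ∈ positiveCone w, (cellMatrix m)ᵀ *ᵥ (fun i => y ⬝ᵥ w i) = x := by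
  simp only [dualCone, transposeImage, Set.mem_image, transpose_coneMatrix_mulVec]

theorem dualCone_pos (m : Fin 4) {x : Fin 3 → ℝ} (hx : x ∈ dualCone m) (j : Fin 3) : 0 < x j := by
  obtain ⟨y, hy, rfl⟩ := (mem_dualCone_iff m x).1 hx
  exact transpose_cellMatrix_mulVec_pos m hy j

/-! ### Convergence of the conical zeta values -/

theorem vertex_gt (k : Fin 5) (i : Fin 3) : 1 / 100 < vertex k i := by
  have h1 := eta_zero_gt
  have h2 := eta_zero_lt
  fin_cases k <;> simp only [Fin.zero_eta, Fin.mk_one, Fin.reduceFinMk, vertex_zero, vertex_one,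
    vertex_two, vertex_three, vertex_four] <;> fin_cases i <;> simp <;> nlinarith

/-- The coordinates of the points of a dual cone are comparable. -/
theorem dualCone_le (m : Fin 4) {x : Fin 3 → ℝ} (hx : x ∈ dualCone m) (j l : Fin 3) :
    x l ≤ 300 * x j := by
  obtain ⟨y, hy, rfl⟩ := (mem_dualCone_iff m x).1 hx
  change ∑ i, vertex (coneIndex m l) i * (y ⬝ᵥ w i) ≤
    300 * ∑ i, vertex (coneIndex m j) i * (y ⬝ᵥ w i)
  rw [Finset.mul_sum]
  refine Finset.sum_le_sum fun i _ => ?_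
  -- The constant `300` is the ratio of the bounds `3` and `1/100`.
  have h1 := vertex_gt (coneIndex m j) i
  have h2 := vertex_lt (coneIndex m l) i
  have h3 : 0 < y ⬝ᵥ w i := hy i
  rw [← mul_assoc]
  exact mul_le_mul_of_nonneg_right (by linarith) h3.le

theorem summable_prod_one_div_pow {k : ℕ} (hk : 2 ≤ k) :
    Summable fun x : Fin 3 → ℤ => ∏ j, |1 / (x j : ℝ) ^ k| := by
  have h : Summable fun n : ℤ => |1 / (n : ℝ) ^ k| :=
    (Real.summable_one_div_int_pow.2 (by omega)).abs
  have h2 := h.mul_of_nonneg (h.mul_of_nonneg h (fun _ => abs_nonneg _) fun _ => abs_nonneg _)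
    (fun _ => abs_nonneg _) fun _ => mul_nonneg (abs_nonneg _) (abs_nonneg _)
  have hinj : Function.Injective fun x : Fin 3 → ℤ => (x 0, x 1, x 2) := by
    intro x y hxy
    simp only [Prod.mk.injEq] at hxy
    ext j
    fin_cases j
    · exact hxy.1
    · exact hxy.2.1
    · exact hxy.2.2
  refine (h2.comp_injective hinj).congr fun x => ?_
  rw [Fin.prod_univ_three, mul_assoc]
  rfl

/-- Exponents equal to 1 do no harm: on the cone all coordinates are comparable to the largest one
`M`, so the term is at most a constant times `M^(-3k)`, which is dominated by the product of three
convergent series. -/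
theorem summable_conicalTerm {k : ℕ} (hk : 2 ≤ k) (m : Fin 4) {κ : Fin 3 → ℕ}
    (hκ : κ ∈ multiIndices 3 (3 * k)) : Summable (conicalTerm (dualCone m) κ) := by
  have h := ((summable_prod_one_div_pow hk).mul_left ((300 : ℝ) ^ (3 * k))).comp_injective
    (Subtype.val_injective (p := fun x : Fin 3 → ℤ => (fun j => (x j : ℝ)) ∈ dualCone m))
  refine h.of_nonneg_of_le (fun x => ?_) fun x => ?_
  · exact one_div_nonneg.2 (Finset.prod_nonneg fun j _ => pow_nonneg (dualCone_pos m x.2 j).le _)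
  · have hp := dualCone_pos m x.2
    obtain ⟨l, hl⟩ := Finite.exists_max fun j => ((x.1 j : ℤ) : ℝ)
    have hM := hp l
    set M : ℝ := ((x.1 l : ℤ) : ℝ)
    have h1 : (M / 300) ^ (3 * k) ≤ ∏ j, (x.1 j : ℝ) ^ κ j := by
      rw [← (mem_multiIndices.1 hκ).1, ← Finset.prod_pow_eq_pow_sum]
      refine Finset.prod_le_prod (fun _ _ => by positivity) fun j _ => ?_
      refine pow_le_pow_left₀ (by positivity) ?_ _
      have : M ≤ 300 * (x.1 j : ℝ) := dualCone_le m x.2 j l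
      linarith
    have h2 : ∏ j, |1 / (x.1 j : ℝ) ^ k| ≥ 1 / M ^ (3 * k) := by
      have e : 1 / M ^ (3 * k) = ∏ _j : Fin 3, 1 / M ^ k := by
        rw [Finset.prod_const, Finset.card_univ, Fintype.card_fin, mul_comm 3 k, pow_mul, div_pow,
          one_pow]
      rw [e]
      refine Finset.prod_le_prod (fun _ _ => by positivity) fun j _ => ?_
      have hj : 0 < (x.1 j : ℝ) := hp j
      rw [abs_of_pos (by positivity)]
      exact one_div_le_one_div_of_le (by positivity) (pow_le_pow_left₀ hj.le (hl j) _)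
    calc conicalTerm (dualCone m) κ x ≤ 1 / (M / 300) ^ (3 * k) :=
          one_div_le_one_div_of_le (by positivity) h1
      _ = 300 ^ (3 * k) * (1 / M ^ (3 * k)) := by rw [div_pow]; field_simp
      _ ≤ _ := mul_le_mul_of_nonneg_left h2 (by positivity)

/-- The totally positive integers of the cubic field. -/
abbrev TotallyPositive : Type := {z : 𝓞 CubicField // ∀ i, 0 < conj i z}

theorem cast_mulVec (m : Fin 4) (x : Fin 3 → ℤ) :
    (fun j => ((((coneMatrix m)ᵀ *ᵥ x) j : ℤ) : ℝ)) =
      (cellMatrix m)ᵀ *ᵥ fun i => conj i (toInteger x) := by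
  simp only [conj_toInteger]
  rw [← transpose_coneMatrix_mulVec]
  ext j
  simp [Matrix.mulVec, dotProduct]

/-- Totally positive integers correspond to the lattice points of the dual cones. -/
def latticeEquiv (m : Fin 4) :
    TotallyPositive ≃ {x : Fin 3 → ℤ // (fun j => (x j : ℝ)) ∈ dualCone m} :=
  Equiv.ofBijective (fun z => ⟨(coneMatrix m)ᵀ *ᵥ (toIntegerEquiv.symm z.1), by
    rw [cast_mulVec, mem_dualCone_iff]
    refine ⟨fun j => (toIntegerEquiv.symm z.1 j : ℝ), fun i => ?_, ?_⟩
    · rw [← conj_toInteger]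
      have := z.2 i
      rwa [← toIntegerEquiv.apply_symm_apply z.1] at this
    · simp only [conj_toInteger]⟩) <| by
  have hdet : ((coneMatrix m)ᵀ).det = 1 := by rw [Matrix.det_transpose, det_coneMatrix]
  have hu : IsUnit ((coneMatrix m)ᵀ).det := by rw [hdet]; exact isUnit_one
  constructor
  · intro z z' h
    have h1 := congrArg (fun y => ((coneMatrix m)ᵀ)⁻¹ *ᵥ y) (congrArg Subtype.val h)
    simp only [Matrix.mulVec_mulVec, Matrix.nonsing_inv_mul _ hu, Matrix.one_mulVec] at h1
    exact Subtype.ext (toIntegerEquiv.symm.injective h1)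
  · rintro ⟨x, hx⟩
    obtain ⟨y, hy, hyx⟩ := hx
    set x' := ((coneMatrix m)ᵀ)⁻¹ *ᵥ x
    have hx' : (coneMatrix m)ᵀ *ᵥ x' = x := by
      rw [Matrix.mulVec_mulVec, Matrix.mul_nonsing_inv _ hu, Matrix.one_mulVec]
    have hyx' : y = fun j => (x' j : ℝ) := by
      have hd : IsUnit (((coneMatrix m).map (Int.cast : ℤ → ℝ))ᵀ).det := by
        rw [Matrix.det_transpose]
        have : ((coneMatrix m).map (Int.cast : ℤ → ℝ)).det = 1 := by
          have := (Int.castRingHom ℝ).map_det (coneMatrix m)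
          rw [det_coneMatrix] at this
          simpa using this.symm
        rw [this]; exact isUnit_one
      apply Matrix.mulVec_injective_of_isUnit ((Matrix.isUnit_iff_isUnit_det _).2 hd)
      change ((coneMatrix m).map (Int.cast : ℤ → ℝ))ᵀ *ᵥ y = fun j => (x j : ℝ) at hyx
      change ((coneMatrix m).map (Int.cast : ℤ → ℝ))ᵀ *ᵥ y = _
      rw [hyx]
      ext j
      rw [← hx']
      simp [Matrix.mulVec, dotProduct]
    refine ⟨⟨toInteger x', fun i => ?_⟩, ?_⟩
    · rw [conj_toInteger, ← hyx']
      exact hy i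
    · apply Subtype.ext
      change (coneMatrix m)ᵀ *ᵥ (toIntegerEquiv.symm (toIntegerEquiv x')) = x
      rw [LinearEquiv.symm_apply_apply, hx']

theorem cast_latticeEquiv (m : Fin 4) (z : TotallyPositive) :
    (fun j => (((latticeEquiv m z).1 j : ℤ) : ℝ)) = (cellMatrix m)ᵀ *ᵥ fun i => conj i z.1 := by
  have h := cast_mulVec m (toIntegerEquiv.symm z.1)
  have e : toInteger (toIntegerEquiv.symm z.1) = z.1 := toIntegerEquiv.apply_symm_apply z.1
  rw [e] at h
  exact h

/-- The `m`-th inner sum as a sum over totally positive integers. -/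
theorem hasSum_coneSum {k : ℕ} (hk : 2 ≤ k) (m : Fin 4) :
    HasSum (fun z : TotallyPositive => coneSum m k ((cellMatrix m)ᵀ *ᵥ fun i => conj i z.1))
      (∑ κ ∈ multiIndices 3 (3 * k), ((∏ j, (κ j - 1).factorial : ℕ) : ℝ) *
        normCoeff wStar (coneMatrix m) k (fun j => κ j - 1) * conicalZeta (dualCone m) κ) := by
  have h : HasSum (fun x : {x : Fin 3 → ℤ // (fun j => (x j : ℝ)) ∈ dualCone m} =>
      coneSum m k fun j => (x.1 j : ℝ)) (∑ κ ∈ multiIndices 3 (3 * k),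
        ((∏ j, (κ j - 1).factorial : ℕ) : ℝ) *
        normCoeff wStar (coneMatrix m) k (fun j => κ j - 1) * conicalZeta (dualCone m) κ) :=
    hasSum_sum fun κ hκ => (summable_conicalTerm hk m hκ).hasSum.mul_left _
  have h' := (latticeEquiv m).hasSum_iff.2 h
  simpa only [Function.comp_def, cast_latticeEquiv] using h'

/-! ### Orbits of totally positive integers and ideals -/

/-- A regulator computation: the logarithms `a < b < c` of the conjugates sum to zero, so `a < 0 <
c` and the determinant `ac - b²` is negative. -/
theorem scale_injective : Function.Injective scale := by
  have h0 : ∀ p, scale p = 1 → p = 0 := by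
    rintro ⟨i, j⟩ h
    have hl : ∀ n, i * Real.log (unitOne n) + j * Real.log (unitTwo n) = 0 := fun n => by
      have := log_scale_mul (t := 1) (fun _ => one_pos) i j n
      rw [h] at this
      simpa using this.symm
    have l0 := hl 0
    have l1 := hl 1
    simp only [unitTwo_eq, Matrix.cons_val] at l0 l1
    have hab := Real.log_lt_log (unitOne_pos 0) unitOne_zero_lt_one
    have hbc := Real.log_lt_log (unitOne_pos 1) unitOne_one_lt_two
    have hs : Real.log (unitOne 0) + Real.log (unitOne 1) + Real.log (unitOne 2) = 0 := by
      rw [← Real.log_mul (unitOne_pos 0).ne' (unitOne_pos 1).ne',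
        ← Real.log_mul (mul_pos (unitOne_pos 0) (unitOne_pos 1)).ne' (unitOne_pos 2).ne',
        prod_unitOne, Real.log_one]
    set a := Real.log (unitOne 0)
    set b := Real.log (unitOne 1)
    set c := Real.log (unitOne 2)
    have hdet : a * c - b ^ 2 ≠ 0 := by
      apply ne_of_lt
      have ha : a < 0 := by linarith
      have hc : 0 < c := by linarith
      have := mul_neg_of_neg_of_pos ha hc
      have := sq_nonneg b
      linarith
    have hi : (i : ℝ) * (a * c - b ^ 2) = 0 := by linear_combination c * l0 - b * l1
    have hj : (j : ℝ) * (a * c - b ^ 2) = 0 := by linear_combination a * l1 - b * l0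
    have hi := (mul_eq_zero.1 hi).resolve_right hdet
    have hj := (mul_eq_zero.1 hj).resolve_right hdet
    exact Prod.ext (by exact_mod_cast hi) (by exact_mod_cast hj)
  intro p q h
  have : scale (p + -q) = 1 := by rw [scale_add, h, ← scale_add, add_neg_cancel, scale_zero]
  exact add_neg_eq_zero.1 (h0 _ this)

theorem exists_totallyPositive_generator (I : {I : Ideal (𝓞 CubicField) // I ≠ ⊥}) :
    ∃ z : TotallyPositive, Ideal.span {z.1} = I.1 := by
  obtain ⟨a, ha⟩ := (IsPrincipalIdealRing.principal I.1).principal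
  have ha' : I.1 = Ideal.span {a} := ha
  have hne : a ≠ 0 := by
    rintro rfl
    exact I.2 (by rw [ha']; simp)
  obtain ⟨u, hu⟩ := exists_unit_mul_totallyPositive hne
  refine ⟨⟨a * u, hu⟩, ?_⟩
  rw [ha', Ideal.span_singleton_eq_span_singleton]
  exact (associated_mul_unit_right a u u.isUnit).symm

/-- A totally positive generator of a nonzero ideal. -/
def generator (I : {I : Ideal (𝓞 CubicField) // I ≠ ⊥}) : TotallyPositive :=
  (exists_totallyPositive_generator I).choose

theorem span_generator (I : {I : Ideal (𝓞 CubicField) // I ≠ ⊥}) :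
    Ideal.span {(generator I).1} = I.1 :=
  (exists_totallyPositive_generator I).choose_spec

theorem conj_unitPow_mul (p : ℤ × ℤ) (z : 𝓞 CubicField) :
    (fun i => conj i (unitPow p * z)) = scale p * fun i => conj i z := by
  ext i
  rw [map_mul, conj_unitPow, Pi.mul_apply]

/-- Totally positive integers up to units are the nonzero ideals. -/
def orbitEquiv : {I : Ideal (𝓞 CubicField) // I ≠ ⊥} × (ℤ × ℤ) ≃ TotallyPositive :=
  Equiv.ofBijective (fun x => ⟨unitPow x.2 * (generator x.1).1, fun i => by
    rw [map_mul, conj_unitPow]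
    exact mul_pos (scale_pos _ _) ((generator x.1).2 i)⟩) <| by
  constructor
  · rintro ⟨I, p⟩ ⟨J, q⟩ h
    have h1 : (unitPow p : 𝓞 CubicField) * (generator I).1 = unitPow q * (generator J).1 :=
      congrArg Subtype.val h
    have hspan : ∀ (p : ℤ × ℤ) (I : {I : Ideal (𝓞 CubicField) // I ≠ ⊥}),
        Ideal.span {(unitPow p : 𝓞 CubicField) * (generator I).1} = I.1 := fun p I => by
      rw [← span_generator I, Ideal.span_singleton_eq_span_singleton]
      exact (associated_unit_mul_right _ _ (unitPow p).isUnit).symm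
    have hIJ : I = J := Subtype.ext (by rw [← hspan p I, h1, hspan])
    subst hIJ
    have h2 : scale p = scale q := by
      ext i
      have h3 := congrArg (conj i) h1
      rw [map_mul, map_mul, conj_unitPow, conj_unitPow] at h3
      exact mul_right_cancel₀ ((generator I).2 i).ne' h3
    rw [scale_injective h2]
  · rintro z
    have hz : z.1 ≠ 0 := fun h => by
      have := z.2 0
      rw [h, map_zero] at this
      exact lt_irrefl _ this
    set I : {I : Ideal (𝓞 CubicField) // I ≠ ⊥} := ⟨Ideal.span {z.1}, by simpa using hz⟩
    have h1 := span_generator I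
    obtain ⟨u, hu⟩ := Ideal.span_singleton_eq_span_singleton.1 h1
    have hup : ∀ i, 0 < conj i u := fun i => by
      have := z.2 i
      rw [← hu, map_mul] at this
      exact (mul_pos_iff_of_pos_left ((generator I).2 i)).1 this
    obtain ⟨p, hp⟩ := exists_unitPow_of_totallyPositive hup
    refine ⟨(I, p), Subtype.ext ?_⟩
    change (unitPow p : 𝓞 CubicField) * (generator I).1 = z.1
    rw [← hp, mul_comm, hu]

theorem prod_conj_generator (I : {I : Ideal (𝓞 CubicField) // I ≠ ⊥}) :
    ∏ i, conj i (generator I).1 = Ideal.absNorm I.1 := by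
  have h := norm_eq_prod_conj (generator I).1
  have hp : 0 < ∏ i, conj i (generator I).1 := Finset.prod_pos fun i _ => (generator I).2 i
  rw [← span_generator I, Ideal.absNorm_span_singleton, ← h]
  have hpos : 0 < Algebra.norm ℤ (generator I).1 := by
    rw [← h] at hp; exact_mod_cast hp
  rw [Nat.cast_natAbs, abs_of_pos hpos]

/-! ### The zeta function -/

/-- The sum over ideals in terms of the sums over dual cones. -/
theorem tsum_ideal {k : ℕ} (hk : 2 ≤ k) :
    ∑' I : Ideal (𝓞 CubicField), ENNReal.ofReal (1 / (Ideal.absNorm I : ℝ) ^ k) =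
      ENNReal.ofReal (1 / (7 * ((k - 1).factorial : ℝ) ^ 3) *
        ∑ m, ∑ κ ∈ multiIndices 3 (3 * k), ((∏ j, (κ j - 1).factorial : ℕ) : ℝ) *
          normCoeff wStar (coneMatrix m) k (fun j => κ j - 1) *
          conicalZeta (dualCone m) κ) := by
  have hk1 : 1 ≤ k := by omega
  set S : Fin 4 → ℝ := fun m => ∑ κ ∈ multiIndices 3 (3 * k),
    ((∏ j, (κ j - 1).factorial : ℕ) : ℝ) *
      normCoeff wStar (coneMatrix m) k (fun j => κ j - 1) * conicalZeta (dualCone m) κ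
  have hnn : ∀ m (z : TotallyPositive),
      0 ≤ coneSum m k ((cellMatrix m)ᵀ *ᵥ fun i => conj i z.1) := fun m z =>
    coneSum_nonneg m hk1 (transpose_cellMatrix_mulVec_pos m z.2)
  have hS : ∀ m, 0 ≤ S m := fun m => (hasSum_coneSum hk m).nonneg (hnn m)
  have h1 : ∀ m, ENNReal.ofReal (S m) = ∑' z : TotallyPositive,
      ENNReal.ofReal (coneSum m k ((cellMatrix m)ᵀ *ᵥ fun i => conj i z.1)) := fun m => by
    rw [← ENNReal.ofReal_tsum_of_nonneg (hnn m) (hasSum_coneSum hk m).summable,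
      (hasSum_coneSum hk m).tsum_eq]
  have h2 : ENNReal.ofReal (∑ m, S m) = ∑' I : {I : Ideal (𝓞 CubicField) // I ≠ ⊥},
      ENNReal.ofReal (7 * ((k - 1).factorial : ℝ) ^ 3) *
        ENNReal.ofReal (1 / (Ideal.absNorm I.1 : ℝ) ^ k) := by
    rw [ENNReal.ofReal_sum_of_nonneg fun m _ => hS m]
    simp only [h1]
    rw [← Summable.tsum_finsetSum fun _ _ => ENNReal.summable, ← orbitEquiv.tsum_eq,
      ENNReal.tsum_prod (f := fun I p => ∑ m, ENNReal.ofReal (coneSum m k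
        ((cellMatrix m)ᵀ *ᵥ fun i => conj i (orbitEquiv (I, p)).1)))]
    refine tsum_congr fun I => ?_
    have e : ∀ p, (fun i => conj i (orbitEquiv (I, p)).1) =
        scale p * fun i => conj i (generator I).1 := fun p => conj_unitPow_mul p _
    simp only [e]
    rw [tsum_coneSum hk1 (generator I).2, prod_conj_generator,
      ← ENNReal.ofReal_mul (by positivity), mul_one_div, mul_div_assoc,
      ENNReal.ofReal_mul (by norm_num)]
    norm_num
  rw [ENNReal.tsum_mul_left] at h2
  have h3 : ∑' I : {I : Ideal (𝓞 CubicField) // I ≠ ⊥},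
      ENNReal.ofReal (1 / (Ideal.absNorm I.1 : ℝ) ^ k) =
      ∑' I : Ideal (𝓞 CubicField), ENNReal.ofReal (1 / (Ideal.absNorm I : ℝ) ^ k) := by
    refine tsum_subtype_eq_of_support_subset (s := {I | I ≠ ⊥})
      (f := fun I : Ideal (𝓞 CubicField) => ENNReal.ofReal (1 / (Ideal.absNorm I : ℝ) ^ k)) ?_
    intro I hI hbot
    apply hI
    -- The zero ideal has norm 0 and contributes `1 / 0 = 0`, so it may be added freely.
    rw [show I = ⊥ from hbot]
    simp [show k ≠ 0 by omega]
  have hc : (0 : ℝ) < 7 * ((k - 1).factorial : ℝ) ^ 3 := by positivity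
  rw [h3] at h2
  rw [ENNReal.ofReal_mul (by positivity), h2, ← mul_assoc, ← ENNReal.ofReal_mul (by positivity),
    one_div_mul_cancel hc.ne', ENNReal.ofReal_one, one_mul]

/-- Ideals are grouped by norm. Convergence is not needed: a divergent sum gives the default value
`0` on both sides. Only `k ≠ 0` matters, for the term at `n = 0`. -/
theorem dedekindZeta_eq_toReal_tsum (K : Type*) [Field K] [NumberField K] {k : ℕ} (hk : k ≠ 0) :
    dedekindZeta K (k : ℂ) =
      (((∑' I : Ideal (𝓞 K), ENNReal.ofReal (1 / (Ideal.absNorm I : ℝ) ^ k)).toReal : ℝ) : ℂ) := by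
  have hfin : ∀ n : ℕ, Finite {I : Ideal (𝓞 K) // Ideal.absNorm I = n} := fun n =>
    (Ideal.finite_setOfPred_absNorm_eq n).to_subtype
  have h1 : ∑' I : Ideal (𝓞 K), ENNReal.ofReal (1 / (Ideal.absNorm I : ℝ) ^ k) =
      ∑' n : ℕ, ENNReal.ofReal
        (Nat.card {I : Ideal (𝓞 K) // Ideal.absNorm I = n} * (1 / (n : ℝ) ^ k)) := by
    rw [← ENNReal.tsum_fiberwise _ (Ideal.absNorm : Ideal (𝓞 K) → ℕ)]
    refine tsum_congr fun n => ?_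
    have e : ∀ b : (Ideal.absNorm : Ideal (𝓞 K) → ℕ) ⁻¹' {n},
        ENNReal.ofReal (1 / (Ideal.absNorm b.1 : ℝ) ^ k) = ENNReal.ofReal (1 / (n : ℝ) ^ k) :=
      fun b => by
        have : Ideal.absNorm b.1 = n := b.2
        rw [this]
    rw [tsum_congr e, ENNReal.tsum_const, ENNReal.ofReal_mul (by positivity),
      ENNReal.ofReal_natCast]
    congr 1
    have := hfin n
    exact congrArg _ (ENat.card_eq_coe_natCard {I : Ideal (𝓞 K) // Ideal.absNorm I = n})
  rw [h1, ENNReal.tsum_toReal_eq fun _ => ENNReal.ofReal_ne_top, Complex.ofReal_tsum, dedekindZeta,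
    LSeries]
  refine tsum_congr fun n => ?_
  rw [LSeries.term_def, ENNReal.toReal_ofReal (by positivity)]
  split_ifs with hn
  · simp [hn, hk]
  · push_cast
    rw [Complex.cpow_natCast, mul_one_div]

theorem dedekindZeta_cubicField {k : ℕ} (hk : 2 ≤ k) :
    dedekindZeta CubicField (k : ℂ) =
      ((1 / (7 * ((k - 1).factorial : ℝ) ^ 3) *
        ∑ i, ∑ κ ∈ multiIndices 3 (3 * k), ((∏ j, (κ j - 1).factorial : ℕ) : ℝ) *
          normCoeff wStar (coneMatrix i) k (fun j => κ j - 1) *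
          conicalZeta (dualCone i) κ : ℝ) : ℂ) := by
  rw [dedekindZeta_eq_toReal_tsum CubicField (by omega), tsum_ideal hk, ENNReal.toReal_ofReal]
  -- Nonnegativity is what lets `ENNReal.ofReal` be stripped off.
  refine mul_nonneg (by positivity) (Finset.sum_nonneg fun m _ => ?_)
  exact (hasSum_coneSum hk m).nonneg fun z =>
    coneSum_nonneg m (by omega) (transpose_cellMatrix_mulVec_pos m z.2)

end ConicalZeta

end

/-! ### The main theorem -/

theorem mainTheorem4 :
    -- the cones `Cᵢ` are totally positive and all conical zeta values involved converge
    (∀ i, ∀ x ∈ ConicalZeta.dualCone i, ∀ j, 0 < x j) ∧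
    (∀ k : ℕ, 2 ≤ k → ∀ i, ∀ κ ∈ ConicalZeta.multiIndices 3 (3 * k),
      Summable (ConicalZeta.conicalTerm (ConicalZeta.dualCone i) κ)) ∧
    -- the formula for all `k ≥ 2`
    (∀ k : ℕ, 2 ≤ k →
      NumberField.dedekindZeta ConicalZeta.CubicField (k : ℂ) =
        ((1 / (7 * ((k - 1).factorial : ℝ) ^ 3) *
          ∑ i, ∑ κ ∈ ConicalZeta.multiIndices 3 (3 * k),
            ((∏ j, (κ j - 1).factorial : ℕ) : ℝ) *
              ConicalZeta.normCoeff ConicalZeta.wStar (ConicalZeta.coneMatrix i) k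
                (fun j => κ j - 1) *
              ConicalZeta.conicalZeta (ConicalZeta.dualCone i) κ : ℝ) : ℂ)) ∧
    -- `k = 2` with the tabulated coefficients
    (∀ i, ∀ κ ∈ ConicalZeta.multiIndices 3 6,
      (ConicalZeta.tableTwo κ i : ℝ) =
        7 ^ 2 * (((∏ j, (κ j - 1).factorial : ℕ) : ℝ) / ((2 - 1).factorial : ℝ) ^ 3 *
          ConicalZeta.normCoeff ConicalZeta.wStar (ConicalZeta.coneMatrix i) 2
            (fun j => κ j - 1))) ∧
    NumberField.dedekindZeta ConicalZeta.CubicField 2 =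
      ((1 / 7 ^ 3 * ∑ i, ∑ κ ∈ ConicalZeta.multiIndices 3 6,
        (ConicalZeta.tableTwo κ i : ℝ) *
          ConicalZeta.conicalZeta (ConicalZeta.dualCone i) κ : ℝ) : ℂ) ∧
    -- `k = 3` with the tabulated coefficients
    (∀ i, ∀ κ ∈ ConicalZeta.multiIndices 3 9,
      (ConicalZeta.tableThree κ i : ℝ) =
        7 ^ 4 * (((∏ j, (κ j - 1).factorial : ℕ) : ℝ) / ((3 - 1).factorial : ℝ) ^ 3 *
          ConicalZeta.normCoeff ConicalZeta.wStar (ConicalZeta.coneMatrix i) 3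
            (fun j => κ j - 1))) ∧
    NumberField.dedekindZeta ConicalZeta.CubicField 3 =
      ((1 / 7 ^ 5 * ∑ i, ∑ κ ∈ ConicalZeta.multiIndices 3 9,
        (ConicalZeta.tableThree κ i : ℝ) *
          ConicalZeta.conicalZeta (ConicalZeta.dualCone i) κ : ℝ) : ℂ) := by
  refine ⟨fun i x hx j => ConicalZeta.dualCone_pos i hx j,
    fun k hk i κ hκ => ConicalZeta.summable_conicalTerm hk i hκ,
    fun k hk => ConicalZeta.dedekindZeta_cubicField hk,
    fun i κ hκ => ConicalZeta.tableTwo_eq i hκ, ?_,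
    fun i κ hκ => ConicalZeta.tableThree_eq i hκ, ?_⟩
  · have h := ConicalZeta.dedekindZeta_cubicField (le_refl 2)
    rw [Nat.cast_ofNat] at h
    rw [h]
    congr 1
    rw [Finset.mul_sum, Finset.mul_sum]
    refine Finset.sum_congr rfl fun i _ => ?_
    rw [Finset.mul_sum, Finset.mul_sum]
    refine Finset.sum_congr rfl fun κ hκ => ?_
    -- The table carries a factor `7²`, so the prefactor `1/7` becomes `1/7³`; for `k = 3` the
    -- factor is `7⁴` and the prefactor `1/7⁵`.
    rw [ConicalZeta.tableTwo_eq i hκ]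
    simp only [Nat.reduceSub, Nat.factorial_one, Nat.cast_one]
    ring
  · have h := ConicalZeta.dedekindZeta_cubicField (show 2 ≤ 3 by norm_num)
    rw [Nat.cast_ofNat] at h
    rw [h]
    congr 1
    rw [Finset.mul_sum, Finset.mul_sum]
    refine Finset.sum_congr rfl fun i _ => ?_
    rw [Finset.mul_sum, Finset.mul_sum]
    refine Finset.sum_congr rfl fun κ hκ => ?_
    rw [ConicalZeta.tableThree_eq i hκ]
    simp only [Nat.reduceSub, Nat.factorial_two, Nat.cast_ofNat]
    ring
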